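/- Let $X$ be a $K$-ary tree with $K\ge 2$: a rooted tree with root $0$ in which every vertex has exactly $K$ children, each edge being an isometric copy of the unit interval; $|x|$ is the resulting distance from $0$ to $x$, and $d|x|$ is the measure on $X$ that is Lebesgue measure on each edge. Fix $\beta>\log K$, $\epsilon>0$, $\lambda\in\mathbb R$ and $C\ge\max\{2|\lambda|/(\beta-\log K),\,2(\log 4)/\epsilon\}$, and equip $X$ with the metric and the measure $$d_X(x,y)=\int_{[x,y]}e^{-\epsilon|z|}\,d|z|,\qquad d\mu_\lambda(x)=e^{-\beta|x|}(|x|+C)^\lambda\,d|x|,$$ where $[x,y]$ is the geodesic from $x$ to $y$; let $ds_X=e^{-\epsilon|z|}d|z|$ be the arc length of $d_X$. For $p\ge1$, the Newtonian space $N^{1,p}(X,\mu_\lambda)$ consists of the measurable functions $u:X\to\mathbb R$ with $$\|u\|_{N^{1,p}(X,\mu_\lambda)}=\Big(\int_X|u|^p\,d\mu_\lambda+\inf_g\int_Xg^p\,d\mu_\lambda\Big)^{1/p}<\infty,$$ the infimum being over all upper gradients $g$ of $u$, i.e. Borel functions $g:X\to[0,\infty]$ with $|u(z)-u(y)|\le\int_{[z,y]}g\,ds_X$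 for all $z,y\in X$. The boundary $\partial X$ is the set of infinite geodesics $\xi$ starting at $0$, with the metric $d_X(\xi,\zeta)=\frac2\epsilon e^{-\epsilon k}$ for $\xi\neq\zeta$ whose last common vertex has distance $k$ from $0$. Let $\nu$ be an Ahlfors $Q$-regular Borel measure on $\partial X$ with $Q=\log K/\epsilon$: there is $c\ge1$ with $c^{-1}r^Q\le\nu(B(\xi,r))\le c\,r^Q$ for all $\xi\in\partial X$ and $0<r\le\operatorname{diam}\partial X$. For a vertex $x$ let $I_x\subset\partial X$ be the set of the $\xi$ that pass through $x$, let $\mathscr Q_n=\{I_x:|x|=n\}$, and let $\widehat I_x=I_y$ where $y$ is the parent of $x$; write $f_I=\frac1{\nu(I)}\int_If\,d\nu$. The Besov-type space $\mathcal B^{\theta,\lambda}_p(\partial X)$ consists of the $f\in L^p(\partial X,\nu)$ with $$\|f\|_{\mathcal B^{\theta,\lambda}_p(\partial X)}=\|f\|_{L^p(\partial X)}+\Big(\sum_{n=1}^\infty e^{\epsilon n\theta p}n^\lambda\sum_{I\in\mathscr Q_n}\nu(I)|f_I-f_{\widehat I}|^p\Big)^{1/p}<\infty.$$ **Theorem.**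 Suppose that $1\le p<\infty$ and $p>(\beta-\log K)/\epsilon$, and set $\theta=1-(\beta-\log K)/(\epsilon p)$. Then $\mathcal B^{\theta,\lambda}_p(\partial X)$ is the trace space of $N^{1,p}(X,\mu_\lambda)$: there are bounded linear operators $T:N^{1,p}(X,\mu_\lambda)\to\mathcal B^{\theta,\lambda}_p(\partial X)$ and $E:\mathcal B^{\theta,\lambda}_p(\partial X)\to N^{1,p}(X,\mu_\lambda)$ with $T\circ E=\mathrm{Id}$. Moreover they can be chosen as follows. For every $u\in N^{1,p}(X,\mu_\lambda)$ and $\nu$-a.e. $\xi$, the limit of $u(x)$ as $x\to\xi$ along the geodesic ray $[0,\xi)$ exists and equals $Tu(\xi)$. For every $f\in\mathcal B^{\theta,\lambda}_p(\partial X)$, $Ef(x)=f_{I_x}$ at each vertex $x$, and on the edge from a vertex $x$ to a child $y$ of $x$ $$Ef(t)=f_{I_x}+\frac{f_{I_y}-f_{I_x}}{d_X(x,y)}\,d_X(x,t),\qquad t\in[x,y].$$ -/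

import Mathlib

open MeasureTheory Filter Topology
open scoped ENNReal NNReal

noncomputable section

/-! # The regular `K`-ary tree

A vertex of the `K`-ary tree is a finite word in the alphabet `Fin K`: the root is the empty word,
and the `K` children of `w` are the words `w ++ [i]`. -/

namespace KaryTree

/-- Points of the metric graph `X` (vertices and points inside edges). A point at distance `s` from
the root is given by `s` together with the word of length `⌈s⌉` naming the first vertex at or below
the point. So a non-root vertex `w` carries the half-open unit edge `|w| - 1 < s ≤ |w|` that joins it
to its parent `w.dropLast`, and the empty word carries the root `s = 0` only. -/
def Pt (K : ℕ) : Type :=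
  {x : ℝ × List (Fin K) // 0 ≤ x.1 ∧ x.2.length = ⌈x.1⌉₊}

variable {K : ℕ}

/-- The distance `|x|` of `x` to the root, all edges having length one. -/
def Pt.height (x : Pt K) : ℝ := x.1.1

/-- The first vertex at or below the point `x`. -/
def Pt.word (x : Pt K) : List (Fin K) := x.1.2

/-- The vertex `w`, as a point of the metric graph. -/
def vertex (w : List (Fin K)) : Pt K := ⟨(w.length, w), by simp⟩

/-- `x.Le y`: the geodesic from the root to `y` passes through `x`. -/
def Pt.Le (x y : Pt K) : Prop := x.height ≤ y.height ∧ x.word <+: y.word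

/-- The geodesic `[x, y]`: the points above `x` or above `y` that are not strictly above the last
common ancestor of `x` and `y`. -/
def geodesic (x y : Pt K) : Set (Pt K) :=
  {z | (z.Le x ∨ z.Le y) ∧ ∀ a : Pt K, a.Le x → a.Le y → a.Le z}

/-- The vertices are a countable discrete set: all sets of vertices are measurable. -/
instance instMeasurableSpaceVertex : MeasurableSpace (List (Fin K)) := ⊤

/-- The Borel `σ`-algebra of `X`: a set is Borel iff its trace on each of the countably many
(half-open) edges is a Borel subset of the line. -/
instance instMeasurableSpacePt : MeasurableSpace (Pt K) :=
  inferInstanceAs (MeasurableSpace {x : ℝ × List (Fin K) // 0 ≤ x.1 ∧ x.2.length = ⌈x.1⌉₊})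

/-- The measure `d|x|` on `X`, which is the Lebesgue measure on each edge. -/
def lengthMeasure (K : ℕ) : Measure (Pt K) :=
  Measure.comap (fun x : Pt K => (x.height, x.word))
    ((volume : Measure ℝ).prod (Measure.count : Measure (List (Fin K))))

/-- The arc length measure `ds_X = e^{-ε|x|} d|x|` of the metric `d_X`. -/
def arcLength (K : ℕ) (ε : ℝ) : Measure (Pt K) :=
  (lengthMeasure K).withDensity fun x => ENNReal.ofReal (Real.exp (-ε * x.height))

/-- The uniformizing metric `d_X(x, y) = ∫_{[x, y]} e^{-ε|z|} d|z|`. -/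
def treeDist (ε : ℝ) (x y : Pt K) : ℝ :=
  ∫ z in geodesic x y, Real.exp (-ε * z.height) ∂(lengthMeasure K)

/-- The weighted measure `dμ_λ = e^{-β|x|} (|x| + C)^λ d|x|`. -/
def weightedMeasure (K : ℕ) (β lam C : ℝ) : Measure (Pt K) :=
  (lengthMeasure K).withDensity fun x =>
    ENNReal.ofReal (Real.exp (-β * x.height) * (x.height + C) ^ lam)

/-! # Newtonian spaces -/

/-- The Borel function `g : X → [0, ∞]` is an upper gradient of `u` with respect to `d_X`. -/
def IsUpperGradient (ε : ℝ) (u : Pt K → ℝ) (g : Pt K → ℝ≥0∞) : Prop :=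
  Measurable g ∧
    ∀ z y : Pt K, ENNReal.ofReal |u z - u y| ≤ ∫⁻ x in geodesic z y, g x ∂(arcLength K ε)

/-- The norm `(∫ |u|^p dμ + inf_g ∫ g^p dμ)^{1/p}`, with the infimum over all upper gradients. -/
def newtonNorm (ε p : ℝ) (μ : Measure (Pt K)) (u : Pt K → ℝ) : ℝ≥0∞ :=
  ((∫⁻ x, ENNReal.ofReal |u x| ^ p ∂μ)
    + ⨅ (g : Pt K → ℝ≥0∞) (_ : IsUpperGradient ε u g), ∫⁻ x, g x ^ p ∂μ) ^ (1 / p)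

theorem newtonNorm_lt_top {ε p : ℝ} (hp : 1 ≤ p) {μ : Measure (Pt K)} {u : Pt K → ℝ} :
    newtonNorm ε p μ u < ∞ ↔ (∫⁻ x, ENNReal.ofReal |u x| ^ p ∂μ) < ∞ ∧
      ∃ g, IsUpperGradient ε u g ∧ ∫⁻ x, g x ^ p ∂μ < ∞ := by
  have : (0 : ℝ) < 1 / p := by positivity
  rw [newtonNorm, ENNReal.rpow_lt_top_iff_of_pos this, ENNReal.add_lt_top]
  simp [iInf_lt_iff]

theorem isUpperGradient_add {ε : ℝ} {u v : Pt K → ℝ} {g h : Pt K → ℝ≥0∞}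
    (hu : IsUpperGradient ε u g) (hv : IsUpperGradient ε v h) :
    IsUpperGradient ε (u + v) (g + h) := by
  refine ⟨hu.1.add hv.1, fun z y => ?_⟩
  calc ENNReal.ofReal |(u + v) z - (u + v) y|
      ≤ ENNReal.ofReal (|u z - u y| + |v z - v y|) := by
        refine ENNReal.ofReal_le_ofReal ?_
        rw [show (u + v) z - (u + v) y = (u z - u y) + (v z - v y) by simp; ring]
        exact abs_add_le _ _
    _ = ENNReal.ofReal |u z - u y| + ENNReal.ofReal |v z - v y| :=
        ENNReal.ofReal_add (abs_nonneg _) (abs_nonneg _)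
    _ ≤ _ := by
        rw [show (fun x => (g + h) x) = fun x => g x + h x from rfl, lintegral_add_left hu.1]
        exact add_le_add (hu.2 z y) (hv.2 z y)

theorem isUpperGradient_smul {ε : ℝ} (c : ℝ) {u : Pt K → ℝ} {g : Pt K → ℝ≥0∞}
    (hu : IsUpperGradient ε u g) :
    IsUpperGradient ε (c • u) (fun x => ENNReal.ofReal |c| * g x) := by
  refine ⟨hu.1.const_mul _, fun z y => ?_⟩
  rw [lintegral_const_mul _ hu.1]
  have : (c • u) z - (c • u) y = c * (u z - u y) := by simp; ring
  rw [this, abs_mul, ENNReal.ofReal_mul (abs_nonneg _)]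
  gcongr
  exact hu.2 z y

/-- The Newtonian space `N^{1,p}(X, μ)`: the measurable functions of finite norm. -/
def newtonSpace (K : ℕ) (ε p : ℝ) (hp : 1 ≤ p) (μ : Measure (Pt K)) :
    Submodule ℝ (Pt K → ℝ) where
  carrier := {u | AEStronglyMeasurable u μ ∧ newtonNorm ε p μ u < ∞}
  zero_mem' := by
    have hp0 : 0 < p := by linarith
    refine ⟨aestronglyMeasurable_const, (newtonNorm_lt_top hp).2 ⟨?_, 0, ⟨measurable_zero, ?_⟩, ?_⟩⟩
    · simp [hp0]
    · simp
    · simp [hp0]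
  add_mem' := by
    rintro u v ⟨hum, hu⟩ ⟨hvm, hv⟩
    obtain ⟨hu1, g, hg, hgp⟩ := (newtonNorm_lt_top hp).1 hu
    obtain ⟨hv1, h, hh, hhp⟩ := (newtonNorm_lt_top hp).1 hv
    refine ⟨hum.add hvm, (newtonNorm_lt_top hp).2 ⟨?_, g + h, isUpperGradient_add hg hh, ?_⟩⟩
    · refine lt_of_le_of_lt (lintegral_mono fun x => ?_)
        (ENNReal.lintegral_rpow_add_lt_top_of_lintegral_rpow_lt_top
          (f := fun x => ENNReal.ofReal |u x|) (g := fun x => ENNReal.ofReal |v x|)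
          hum.norm.aemeasurable.ennreal_ofReal hu1 hv1 hp)
      refine ENNReal.rpow_le_rpow ?_ (by linarith)
      simp only [Pi.add_apply]
      rw [← ENNReal.ofReal_add (abs_nonneg _) (abs_nonneg _)]
      exact ENNReal.ofReal_le_ofReal (abs_add_le _ _)
    · exact ENNReal.lintegral_rpow_add_lt_top_of_lintegral_rpow_lt_top hg.1.aemeasurable hgp hhp hp
  smul_mem' := by
    rintro c u ⟨hum, hu⟩
    have hp0 : 0 ≤ p := by linarith
    have hc : ENNReal.ofReal |c| ^ p ≠ ∞ := ENNReal.rpow_ne_top_of_nonneg hp0 ENNReal.ofReal_ne_top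
    obtain ⟨hu1, g, hg, hgp⟩ := (newtonNorm_lt_top hp).1 hu
    refine ⟨hum.const_smul c, (newtonNorm_lt_top hp).2 ⟨?_, _, isUpperGradient_smul c hg, ?_⟩⟩
    · simp only [Pi.smul_apply, smul_eq_mul, abs_mul, ENNReal.ofReal_mul (abs_nonneg c),
        ENNReal.mul_rpow_of_nonneg _ _ hp0]
      rw [lintegral_const_mul' _ _ hc]
      exact ENNReal.mul_lt_top hc.lt_top hu1
    · simp only [ENNReal.mul_rpow_of_nonneg _ _ hp0]
      rw [lintegral_const_mul' _ _ hc]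
      exact ENNReal.mul_lt_top hc.lt_top hgp

/-! # The boundary -/

/-- The boundary `∂X`: the infinite geodesics `0 x₁ x₂ …` from the root. The geodesic `ξ` passes at
height `n` through the vertex `(ξ 0, …, ξ (n - 1))`. Its Borel `σ`-algebra is the product one. -/
abbrev Boundary (K : ℕ) : Type := ℕ → Fin K

/-- `d_X(ξ, ζ) = (2/ε) e^{-εk}`, with `k` the height at which `ξ` and `ζ` separate. -/
def boundaryDist (ε : ℝ) (ξ ζ : Boundary K) : ℝ :=
  open scoped Classical in
  if ξ = ζ then 0 else 2 / ε * Real.exp (-ε * (PiNat.firstDiff ξ ζ : ℝ))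

/-- Ahlfors regularity of `ν`, with the exponent `Q = log K / ε`:
`ν(B(ξ, r)) ≈ r^Q` for `0 < r ≤ diam ∂X = 2/ε`. -/
def AhlforsRegular (ε : ℝ) (ν : Measure (Boundary K)) : Prop :=
  ∃ c : ℝ, 1 ≤ c ∧ ∀ (ξ : Boundary K) (r : ℝ), 0 < r → r ≤ 2 / ε →
    ENNReal.ofReal (c⁻¹ * r ^ (Real.log K / ε)) ≤ ν {ζ | boundaryDist ε ξ ζ < r} ∧
    ν {ζ | boundaryDist ε ξ ζ < r} ≤ ENNReal.ofReal (c * r ^ (Real.log K / ε))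

theorem AhlforsRegular.isFiniteMeasure {ε : ℝ} (hε : 0 < ε) {ν : Measure (Boundary K)}
    (hν : AhlforsRegular ε ν) : IsFiniteMeasure ν := by
  obtain ⟨c, -, h⟩ := hν
  have hε2 : 0 < 2 / ε := by positivity
  have hcov : (Set.univ : Set (Boundary K)) ⊆
      ⋃ i : Fin K, {ζ | boundaryDist ε (fun _ => i) ζ < 2 / ε} := by
    intro ζ _
    refine Set.mem_iUnion.2 ⟨ζ 0, ?_⟩
    change boundaryDist ε (fun _ => ζ 0) ζ < 2 / ε
    unfold boundaryDist
    split_ifs with heq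
    · exact hε2
    · have h0 : PiNat.firstDiff (fun _ => ζ 0 : Boundary K) ζ ≠ 0 := by
        intro h0
        have := PiNat.apply_firstDiff_ne heq
        rw [h0] at this
        exact this rfl
      have h1 : (0 : ℝ) < PiNat.firstDiff (fun _ => ζ 0 : Boundary K) ζ := by
        exact_mod_cast Nat.pos_of_ne_zero h0
      refine mul_lt_of_lt_one_right hε2 (Real.exp_lt_one_iff.2 ?_)
      nlinarith
  refine ⟨lt_of_le_of_lt (measure_mono hcov) (lt_of_le_of_lt (measure_iUnion_le _) ?_)⟩
  rw [tsum_fintype]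
  exact ENNReal.sum_lt_top.2 fun i _ => lt_of_le_of_lt (h _ _ hε2 le_rfl).2 ENNReal.ofReal_lt_top

/-- The dyadic set `I_w`: the geodesics from the root that pass through the vertex `w`. -/
def dyadic (w : List (Fin K)) : Set (Boundary K) :=
  {ξ | ∀ (i : ℕ) (hi : i < w.length), ξ i = w[i]}

/-- The mean value `f_I` of `f` over `I = I_w`. -/
def mean (ν : Measure (Boundary K)) (f : Boundary K → ℝ) (w : List (Fin K)) : ℝ :=
  ⨍ ξ in dyadic w, f ξ ∂ν

/-! # Besov-type spaces -/

/-- The `p`-th power of the dyadic energy,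
`∑_{n ≥ 1} e^{εnθp} n^λ ∑_{I ∈ 𝒬_n} ν(I) |f_I - f_Î|^p`, where the vertices of level `n` are the words
of length `n` and `Î` belongs to the parent of the vertex that defines `I`. -/
def dyadicEnergy (ε p θ lam : ℝ) (ν : Measure (Boundary K)) (f : Boundary K → ℝ) : ℝ≥0∞ :=
  ∑' m : ℕ, ENNReal.ofReal (Real.exp (ε * ((m : ℝ) + 1) * θ * p) * ((m : ℝ) + 1) ^ lam) *
    ∑ w : Fin (m + 1) → Fin K, ν (dyadic (List.ofFn w)) *
      ENNReal.ofReal |mean ν f (List.ofFn w) - mean ν f (List.ofFn w).dropLast| ^ p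

/-- The norm `‖f‖_{L^p} + (energy)^{1/p}`. -/
def besovNorm (ε p θ lam : ℝ) (ν : Measure (Boundary K)) (f : Boundary K → ℝ) : ℝ≥0∞ :=
  eLpNorm f (ENNReal.ofReal p) ν + dyadicEnergy ε p θ lam ν f ^ (1 / p)

theorem dyadicEnergy_add_lt_top {ε p θ lam : ℝ} (hp : 1 ≤ p) {ν : Measure (Boundary K)}
    {f g h : Boundary K → ℝ} (hm : ∀ w, mean ν h w = mean ν f w + mean ν g w)
    (hf : dyadicEnergy ε p θ lam ν f < ∞) (hg : dyadicEnergy ε p θ lam ν g < ∞) :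
    dyadicEnergy ε p θ lam ν h < ∞ := by
  have hle : dyadicEnergy ε p θ lam ν h ≤
      2 ^ (p - 1) * (dyadicEnergy ε p θ lam ν f + dyadicEnergy ε p θ lam ν g) := by
    unfold dyadicEnergy
    rw [← ENNReal.tsum_add, ← ENNReal.tsum_mul_left]
    refine ENNReal.tsum_le_tsum fun m => ?_
    rw [← mul_add, ← Finset.sum_add_distrib, mul_left_comm]
    refine mul_le_mul_right ?_ _
    rw [Finset.mul_sum]
    refine Finset.sum_le_sum fun w _ => ?_
    rw [← mul_add, mul_left_comm]
    gcongr
    refine le_trans (ENNReal.rpow_le_rpow ?_ (by linarith))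
      (ENNReal.rpow_add_le_mul_rpow_add_rpow _ _ hp)
    rw [← ENNReal.ofReal_add (abs_nonneg _) (abs_nonneg _), hm, hm, add_sub_add_comm]
    exact ENNReal.ofReal_le_ofReal (abs_add_le _ _)
  refine lt_of_le_of_lt hle (ENNReal.mul_lt_top ?_ (ENNReal.add_lt_top.2 ⟨hf, hg⟩))
  exact ENNReal.rpow_lt_top_of_nonneg (by linarith) (by simp)

theorem dyadicEnergy_smul_lt_top {ε p θ lam : ℝ} (hp : 1 ≤ p) {ν : Measure (Boundary K)}
    (c : ℝ) {f h : Boundary K → ℝ} (hm : ∀ w, mean ν h w = c * mean ν f w)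
    (hf : dyadicEnergy ε p θ lam ν f < ∞) : dyadicEnergy ε p θ lam ν h < ∞ := by
  have hp0 : 0 ≤ p := by linarith
  have hle : dyadicEnergy ε p θ lam ν h = ENNReal.ofReal |c| ^ p * dyadicEnergy ε p θ lam ν f := by
    unfold dyadicEnergy
    rw [← ENNReal.tsum_mul_left]
    refine tsum_congr fun m => ?_
    rw [mul_left_comm]
    refine congrArg _ ?_
    rw [Finset.mul_sum]
    refine Finset.sum_congr rfl fun w _ => ?_
    rw [mul_left_comm, hm, hm, ← mul_sub, abs_mul, ENNReal.ofReal_mul (abs_nonneg _),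
      ENNReal.mul_rpow_of_nonneg _ _ hp0]
  rw [hle]
  exact ENNReal.mul_lt_top (ENNReal.rpow_lt_top_of_nonneg hp0 ENNReal.ofReal_ne_top) hf

/-- The Besov-type space `ℬ^{θ,λ}_p(∂X)`: the functions in `L^p(∂X, ν)` of finite dyadic energy. -/
def besovSpace (ε p θ lam : ℝ) (hε : 0 < ε) (hp : 1 ≤ p) (ν : Measure (Boundary K))
    (hν : AhlforsRegular ε ν) : Submodule ℝ (Lp ℝ (ENNReal.ofReal p) ν) where
  carrier := {f | dyadicEnergy ε p θ lam ν f < ∞}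
  zero_mem' := by
    have hp0 : 0 < p := by linarith
    have hm : ∀ w, mean ν ((0 : Lp ℝ (ENNReal.ofReal p) ν) : Boundary K → ℝ) w = 0 := fun w => by
      rw [mean, setAverage_eq, integral_congr_ae (ae_restrict_of_ae (Lp.coeFn_zero ℝ _ ν))]
      simp
    change dyadicEnergy ε p θ lam ν ((0 : Lp ℝ (ENNReal.ofReal p) ν) : Boundary K → ℝ) < ∞
    simp only [dyadicEnergy, hm, sub_zero, abs_zero, ENNReal.ofReal_zero, ENNReal.zero_rpow_of_pos hp0,
      mul_zero, Finset.sum_const_zero, tsum_zero, ENNReal.zero_lt_top]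
  add_mem' := by
    intro f g hf hg
    have := hν.isFiniteMeasure hε
    have h1 : (1 : ℝ≥0∞) ≤ ENNReal.ofReal p := by simpa using hp
    refine dyadicEnergy_add_lt_top hp (fun w => ?_) hf hg
    rw [mean, mean, mean, setAverage_eq, setAverage_eq, setAverage_eq,
      integral_congr_ae (ae_restrict_of_ae (Lp.coeFn_add f g)), ← smul_add]
    congr 1
    exact integral_add ((Lp.memLp f).integrable h1).integrableOn
      ((Lp.memLp g).integrable h1).integrableOn
  smul_mem' := by
    intro c f hf
    refine dyadicEnergy_smul_lt_top hp c (fun w => ?_) hf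
    rw [mean, mean, setAverage_eq, setAverage_eq,
      integral_congr_ae (ae_restrict_of_ae (Lp.coeFn_smul c f))]
    simp only [Pi.smul_apply, smul_eq_mul, integral_const_mul]
    ring

/-! # Limits along rays, and the extension by averages -/

/-- The filter of the limit `x → ξ` along the geodesic ray `[0, ξ)`: the points `x` of the ray (those
whose lower vertex lies on `ξ`), as `|x| → ∞`. -/
def rayFilter (ξ : Boundary K) : Filter (Pt K) :=
  comap Pt.height atTop ⊓ 𝓟 {x | ξ ∈ dyadic x.word}

/-- The extension of `f` to `X`: the mean value over `I_v` at each vertex `v`, interpolated on each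
edge linearly with respect to `d_X`. The point `x` lies on the edge from `x.word.dropLast` to
`x.word`; at the root both are the root, and the value is the mean over `∂X`. -/
def extension (ε : ℝ) (ν : Measure (Boundary K)) (f : Boundary K → ℝ) (x : Pt K) : ℝ :=
  mean ν f x.word.dropLast +
    (mean ν f x.word - mean ν f x.word.dropLast) /
      treeDist ε (vertex x.word.dropLast) (vertex x.word) *
      treeDist ε (vertex x.word.dropLast) x

end KaryTree

end

/-!
The weight of `μ_λ` on an edge at level `n` is about `e^{-βn} n^λ`, such an edge has `d_X`-length
about `e^{-εn}`, and `ν(I_w) ≈ K^{-n}`. With `εθp = εp - β + log K`, the weight `e^{εnθp} n^λ ν(I)` of the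
dyadic energy is therefore comparable to `e^{-βn} n^λ` times the `p`-th power of `e^{εn}`
(`besovWeight_eq`): a jump along an edge costs the same in the energy on `∂X` and, as the slope of a
function on the edge, in `L^p(μ_λ)`.

*Trace.* Let `g` be an upper gradient of `u`, and let `G_m(ξ)` be the integral of `g` over the
`(m + 1)`-st edge of the ray `ξ` (`rayIncrement`). Hölder's inequality on each edge bounds
`∑ m, W_m ∫ G_m^p dν`, with `W_m` the weights of the energy, by `∫ g^p dμ_λ`
(`exists_tsum_rayIncrement_le`). Since `θ > 0` the weights `W_m` grow geometrically, and a weighted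
Hardy inequality (`tsum_mul_tail_rpow_le`) gives the same bound for the tails `H_m = ∑ j, G_{m+j}`.
So `H_0` is finite almost everywhere, `u` has a limit `Tu(ξ)` along almost every ray, and
`|Tu(ξ) - u(ξ_m)| ≤ H_m(ξ)`, where `ξ_m` is the vertex of `ξ` at height `m`. By Jensen's inequality,
the mean values of `Tu` over the dyadic sets of the levels `m` and `m + 1` differ from `u(ξ_m)` by at
most the corresponding averages of `H_m`, which bounds the energy (`dyadicEnergy_trace_le`). The `L^p`
norm of `Tu` is controlled by `H_0` and the value of `u` at the root (`exists_root_rpow_le`).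

*Extension.* The slope of `Ef` on the edge of `w` is an upper gradient, because on a tree this can be
checked edge by edge (`isUpperGradient_of_edge`), and its norm is the dyadic energy up to constants.
The `L^p` norm of `Ef` is summed over the levels, where `β > log K` makes the masses
`K^n e^{-βn} n^λ` summable. Finally `T(Ef) = f` since the mean values `f_{I}` converge to `f` almost
everywhere, by martingale convergence (`tendsto_mean_vertexAt`).
-/

namespace KaryTree

variable {K : ℕ}

/-! ### Inequalities for integrals and series -/

theorem lintegral_rpow_le_measure_univ_mul {α : Type*} [MeasurableSpace α] {μ : Measure α} {p : ℝ}
    (hp : 1 ≤ p) {h : α → ℝ≥0∞} (hh : AEMeasurable h μ) :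
    (∫⁻ a, h a ∂μ) ^ p ≤ μ Set.univ ^ (p - 1) * ∫⁻ a, h a ^ p ∂μ := by
  have hp0 : 0 < p := by linarith
  have key := eLpNorm'_le_eLpNorm'_mul_rpow_measure_univ (μ := μ) (f := h) one_pos hp
    hh.aestronglyMeasurable
  simp only [eLpNorm'_eq_lintegral_enorm, enorm_eq_self, ENNReal.rpow_one, div_one] at key
  calc (∫⁻ a, h a ∂μ) ^ p
      ≤ ((∫⁻ a, h a ^ p ∂μ) ^ (1 / p) * μ Set.univ ^ (1 - 1 / p)) ^ p :=
        ENNReal.rpow_le_rpow key hp0.le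
    _ = μ Set.univ ^ (p - 1) * ∫⁻ a, h a ^ p ∂μ := by
        rw [ENNReal.mul_rpow_of_nonneg _ _ hp0.le, ← ENNReal.rpow_mul, ← ENNReal.rpow_mul,
          one_div_mul_cancel hp0.ne', ENNReal.rpow_one, mul_comm]
        congr 2
        field_simp

theorem tsum_mul_rpow_le {p : ℝ} (hp : 1 ≤ p) (c h : ℕ → ℝ≥0∞) :
    (∑' j, c j * h j) ^ p ≤ (∑' j, c j) ^ (p - 1) * ∑' j, c j * h j ^ p := by
  have := lintegral_rpow_le_measure_univ_mul (μ := Measure.count.withDensity c) hp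
    (measurable_of_countable h).aemeasurable
  simpa [lintegral_withDensity_eq_lintegral_mul _ (measurable_of_countable c)
    (measurable_of_countable _), lintegral_count] using this

/-- A weighted discrete Hardy inequality: if the weights `ω` grow fast enough, the operator of tail
sums is bounded on `ℓ^p(ω)`. It is the triangle inequality for the shifts of `G`, the `j`-th of which
has norm at most `c j`. -/
theorem tsum_mul_tail_rpow_le {p : ℝ} (hp : 1 ≤ p) {ω c : ℕ → ℝ≥0∞} (hc0 : ∀ j, c j ≠ 0)
    (hc : ∑' j, c j ≠ ∞) (hω : ∀ n j, ω n ≤ c j ^ p * ω (n + j)) (G : ℕ → ℝ≥0∞) :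
    ∑' n, ω n * (∑' j, G (n + j)) ^ p ≤ (∑' j, c j) ^ p * ∑' n, ω n * G n ^ p := by
  have hp0 : 0 < p := by linarith
  have hct : ∀ j, c j ≠ ∞ := ENNReal.ne_top_of_tsum_ne_top hc
  have hS0 : ∑' j, c j ≠ 0 := fun h => hc0 0 (ENNReal.tsum_eq_zero.1 h 0)
  have h1 : ∀ n, (∑' j, G (n + j)) ^ p
      ≤ (∑' j, c j) ^ (p - 1) * ∑' j, c j * (G (n + j) / c j) ^ p := fun n => by
    refine le_trans (le_of_eq ?_) (tsum_mul_rpow_le hp c fun j => G (n + j) / c j)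
    congr 1
    exact tsum_congr fun j => (ENNReal.mul_div_cancel (hc0 j) (hct j)).symm
  have h2 : ∀ n j, ω n * (c j * (G (n + j) / c j) ^ p) ≤ c j * (ω (n + j) * G (n + j) ^ p) := by
    intro n j
    have hcp0 : c j ^ p ≠ 0 := (ENNReal.rpow_pos (pos_iff_ne_zero.2 (hc0 j)) (hct j)).ne'
    have hcp : c j ^ p ≠ ∞ := ENNReal.rpow_ne_top_of_nonneg hp0.le (hct j)
    calc ω n * (c j * (G (n + j) / c j) ^ p)
        ≤ (c j ^ p * ω (n + j)) * (c j * (G (n + j) / c j) ^ p) := by gcongr; exact hω n j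
      _ = c j * (ω (n + j) * (c j ^ p * (G (n + j) / c j) ^ p)) := by ring
      _ = _ := by
        rw [← ENNReal.mul_rpow_of_nonneg _ _ hp0.le, ENNReal.mul_div_cancel (hc0 j) (hct j)]
  calc ∑' n, ω n * (∑' j, G (n + j)) ^ p
      ≤ ∑' n, ω n * ((∑' j, c j) ^ (p - 1) * ∑' j, c j * (G (n + j) / c j) ^ p) :=
        ENNReal.tsum_le_tsum fun n => by gcongr; exact h1 n
    _ = (∑' j, c j) ^ (p - 1) * ∑' n, ∑' j, ω n * (c j * (G (n + j) / c j) ^ p) := by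
        rw [← ENNReal.tsum_mul_left]
        refine tsum_congr fun n => ?_
        rw [ENNReal.tsum_mul_left]; ring
    _ ≤ (∑' j, c j) ^ (p - 1) * ∑' n, ∑' j, c j * (ω (n + j) * G (n + j) ^ p) := by
        exact mul_le_mul' le_rfl
          (ENNReal.tsum_le_tsum fun n => ENNReal.tsum_le_tsum fun j => h2 n j)
    _ = (∑' j, c j) ^ (p - 1) * ∑' j, c j * ∑' n, (ω (n + j) * G (n + j) ^ p) := by
        rw [ENNReal.tsum_comm]
        simp only [ENNReal.tsum_mul_left]
    _ ≤ (∑' j, c j) ^ (p - 1) * ∑' j, c j * ∑' n, (ω n * G n ^ p) := by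
        exact mul_le_mul' le_rfl (ENNReal.tsum_le_tsum fun j => mul_le_mul' le_rfl
          (ENNReal.tsum_comp_le_tsum_of_injective (add_left_injective j) fun n => ω n * G n ^ p))
    _ = (∑' j, c j) ^ p * ∑' n, ω n * G n ^ p := by
        rw [ENNReal.tsum_mul_right, ← mul_assoc]
        congr 1
        nth_rewrite 2 [← ENNReal.rpow_one (∑' j, c j)]
        rw [← ENNReal.rpow_add _ _ hS0 hc, sub_add_cancel]

theorem summable_exp_mul_rpow {δ : ℝ} (hδ : 0 < δ) (s : ℝ) :
    Summable fun j : ℕ => Real.exp (-(δ * ((j : ℝ) + 1))) * ((j : ℝ) + 1) ^ s := by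
  have h := (summable_nat_add_iff 1).2 (Real.summable_pow_mul_exp_neg_nat_mul ⌈s⌉₊ hδ)
  refine Summable.of_nonneg_of_le (fun j => by positivity) (fun j => ?_) h
  rw [mul_comm]
  push_cast
  rw [neg_mul]
  gcongr
  rw [← Real.rpow_natCast]
  exact Real.rpow_le_rpow_of_exponent_le (by linarith [(Nat.cast_nonneg j : (0 : ℝ) ≤ j)])
    (Nat.le_ceil s)

theorem rpow_le_rpow_abs {κ r : ℝ} (hκ : 1 ≤ κ) (hr : κ⁻¹ ≤ r) (hrκ : r ≤ κ) (s : ℝ) :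
    r ^ s ≤ κ ^ |s| := by
  have hκ0 : 0 < κ := by linarith
  have hr0 : 0 < r := lt_of_lt_of_le (by positivity) hr
  rcases le_total 0 s with hs | hs
  · rw [abs_of_nonneg hs]
    exact Real.rpow_le_rpow hr0.le hrκ hs
  · rw [abs_of_nonpos hs, Real.rpow_neg hκ0.le, ← Real.inv_rpow hκ0.le]
    exact Real.rpow_le_rpow_of_nonpos (by positivity) hr hs

/-- A form of Jensen's inequality. -/
theorem ofReal_abs_integral_sub_rpow_le {α : Type*} [MeasurableSpace α] {μ : Measure α}
    [IsProbabilityMeasure μ] {p : ℝ} (hp : 1 ≤ p) {f : α → ℝ} (hf : Integrable f μ) (a : ℝ) :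
    ENNReal.ofReal |∫ x, f x ∂μ - a| ^ p ≤ ∫⁻ x, ENNReal.ofReal |f x - a| ^ p ∂μ := by
  have h1 : ∫ x, f x ∂μ - a = ∫ x, (f x - a) ∂μ := by
    rw [integral_sub hf (integrable_const a)]; simp
  have h2 : ENNReal.ofReal |∫ x, f x ∂μ - a| ≤ ∫⁻ x, ENNReal.ofReal |f x - a| ∂μ := by
    rw [h1]
    simpa only [Real.enorm_eq_ofReal_abs] using enorm_integral_le_lintegral_enorm
      (μ := μ) fun x => f x - a
  have hm : AEMeasurable (fun x => ENNReal.ofReal |f x - a|) μ := by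
    have := (hf.aestronglyMeasurable.sub (aestronglyMeasurable_const (b := a))).norm.aemeasurable
    exact this.ennreal_ofReal
  calc _ ≤ (∫⁻ x, ENNReal.ofReal |f x - a| ∂μ) ^ p := ENNReal.rpow_le_rpow h2 (by linarith)
    _ ≤ _ := lintegral_rpow_le_measure_univ_mul hp hm
    _ = _ := by simp

theorem ofReal_abs_sub_rpow_le {p : ℝ} (hp : 1 ≤ p) (x y a : ℝ) :
    ENNReal.ofReal |x - y| ^ p ≤
      2 ^ (p - 1) * (ENNReal.ofReal |x - a| ^ p + ENNReal.ofReal |y - a| ^ p) := by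
  refine le_trans (ENNReal.rpow_le_rpow ?_ (by linarith))
      (ENNReal.rpow_add_le_mul_rpow_add_rpow _ _ hp)
  rw [← ENNReal.ofReal_add (abs_nonneg _) (abs_nonneg _), abs_sub_comm y a]
  exact ENNReal.ofReal_le_ofReal (abs_sub_le _ _ _)

/-! ### Dyadic sets of the boundary -/

/-- The vertex at height `n` on the infinite geodesic `ξ`, as a word. -/
def vertexAt (ξ : Boundary K) (n : ℕ) : List (Fin K) := List.ofFn fun i : Fin n => ξ i

@[simp] theorem length_vertexAt (ξ : Boundary K) (n : ℕ) : (vertexAt ξ n).length = n := by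
  simp [vertexAt]

@[simp] theorem vertexAt_zero (ξ : Boundary K) : vertexAt ξ 0 = [] := by simp [vertexAt]

theorem take_vertexAt (ξ : Boundary K) {m n : ℕ} (h : m ≤ n) :
    (vertexAt ξ n).take m = vertexAt ξ m := by
  refine List.ext_getElem (by simpa using h) fun i h1 h2 => ?_
  simp [vertexAt]

theorem dropLast_vertexAt (ξ : Boundary K) (n : ℕ) :
    (vertexAt ξ (n + 1)).dropLast = vertexAt ξ n := by
  rw [List.dropLast_eq_take, length_vertexAt, take_vertexAt ξ (by simp), Nat.add_sub_cancel]

theorem mem_dyadic_iff {ξ : Boundary K} {w : List (Fin K)} :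
    ξ ∈ dyadic w ↔ vertexAt ξ w.length = w := by
  constructor
  · intro h
    refine List.ext_getElem (by simp) fun i h1 h2 => ?_
    simpa [vertexAt] using h i h2
  · intro h i hi
    have : (vertexAt ξ w.length)[i]'(by simpa using hi) = ξ i := by simp [vertexAt]
    rw [← this]
    simp only [h]

theorem mem_dyadic_ofFn {n : ℕ} {ξ : Boundary K} {w : Fin n → Fin K} :
    ξ ∈ dyadic (List.ofFn w) ↔ (fun i : Fin n => ξ i) = w := by
  rw [mem_dyadic_iff, List.length_ofFn]
  exact List.ofFn_injective.eq_iff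

theorem measurable_vertexAt (n : ℕ) : Measurable fun ξ : Boundary K => vertexAt ξ n :=
  (measurable_of_countable (List.ofFn (α := Fin K) (n := n))).comp
    (measurable_pi_lambda _ fun _ => measurable_pi_apply _)

theorem measurableSet_dyadic (w : List (Fin K)) : MeasurableSet (dyadic w) := by
  have : dyadic w = (fun ξ : Boundary K => vertexAt ξ w.length) ⁻¹' {w} := by
    ext ξ; exact mem_dyadic_iff
  rw [this]
  exact measurable_vertexAt _ (MeasurableSpace.measurableSet_top)

theorem pairwise_disjoint_dyadic (n : ℕ) :
    Pairwise (Function.onFun Disjoint fun w : Fin n → Fin K => dyadic (List.ofFn w)) := by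
  intro v w hvw
  refine Set.disjoint_left.2 fun ξ hv hw => hvw ?_
  rw [mem_dyadic_ofFn] at hv hw
  exact hv.symm.trans hw

theorem iUnion_dyadic (n : ℕ) : ⋃ w : Fin n → Fin K, dyadic (List.ofFn w) = Set.univ :=
  Set.eq_univ_of_forall fun _ => Set.mem_iUnion.2 ⟨_, mem_dyadic_ofFn.2 rfl⟩

theorem sum_setLIntegral_dyadic (ν : Measure (Boundary K)) (n : ℕ) (h : Boundary K → ℝ≥0∞) :
    ∑ w : Fin n → Fin K, ∫⁻ ξ in dyadic (List.ofFn w), h ξ ∂ν = ∫⁻ ξ, h ξ ∂ν := by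
  rw [← tsum_fintype (L := .unconditional _), ← lintegral_iUnion (fun w => measurableSet_dyadic _)
    (pairwise_disjoint_dyadic n), iUnion_dyadic, Measure.restrict_univ]

theorem sum_measure_dyadic_mul (ν : Measure (Boundary K)) (n : ℕ) (φ : List (Fin K) → ℝ≥0∞) :
    ∑ w : Fin n → Fin K, ν (dyadic (List.ofFn w)) * φ (List.ofFn w)
      = ∫⁻ ξ, φ (vertexAt ξ n) ∂ν := by
  rw [← sum_setLIntegral_dyadic ν n]
  refine Finset.sum_congr rfl fun w _ => ?_
  rw [setLIntegral_congr_fun (g := fun _ => φ (List.ofFn w)) (measurableSet_dyadic _),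
    setLIntegral_const, mul_comm]
  intro ξ hξ
  have := mem_dyadic_iff.1 hξ
  rw [List.length_ofFn] at this
  simp only [this]

/-! ### Ahlfors regularity -/

/-- The open balls of the boundary are dyadic sets. As the inequality is strict, the radius
`(2/ε) e^{-εn}` gives the level `n + 1`. -/
theorem boundaryDist_lt_iff {ε : ℝ} (hε : 0 < ε) {ξ ζ : Boundary K} (n : ℕ) :
    boundaryDist ε ξ ζ < 2 / ε * Real.exp (-ε * n) ↔ ζ ∈ dyadic (vertexAt ξ (n + 1)) := by
  have hε2 : 0 < 2 / ε := by positivity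
  have hmem : ζ ∈ dyadic (vertexAt ξ (n + 1)) ↔ ∀ i ≤ n, ξ i = ζ i := by
    rw [vertexAt, mem_dyadic_ofFn, funext_iff]
    exact ⟨fun h i hi => (h ⟨i, by omega⟩).symm, fun h i => (h i (by omega)).symm⟩
  rw [hmem]
  by_cases heq : ξ = ζ
  · simp [boundaryDist, heq, hε2, Real.exp_pos]
  · rw [boundaryDist, if_neg heq, mul_lt_mul_iff_right₀ hε2, Real.exp_lt_exp]
    have : (-ε * (PiNat.firstDiff ξ ζ : ℝ) < -ε * n) ↔ n < PiNat.firstDiff ξ ζ := by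
      rw [neg_mul, neg_mul, neg_lt_neg_iff, mul_lt_mul_iff_right₀ hε, Nat.cast_lt]
    rw [this]
    constructor
    · intro h i hi
      exact PiNat.apply_eq_of_lt_firstDiff (by omega)
    · intro h
      by_contra hn
      exact PiNat.apply_firstDiff_ne heq (h _ (by omega))

/-- For an Ahlfors regular measure, the dyadic sets of level `n` have measure comparable to
`K ^ (-n)`. -/
theorem AhlforsRegular.exists_measure_dyadic {ε : ℝ} (hK : 2 ≤ K) (hε : 0 < ε)
    {ν : Measure (Boundary K)} (hν : AhlforsRegular ε ν) :
    ∃ c : ℝ≥0, ∀ w : List (Fin K), ν (dyadic w) * (K : ℝ≥0∞) ^ w.length ≤ c ∧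
      1 ≤ c * (K : ℝ≥0∞) ^ w.length * ν (dyadic w) := by
  have hfin := hν.isFiniteMeasure hε
  obtain ⟨c, hc, h⟩ := hν
  have hKpos : (0 : ℝ) < K := by exact_mod_cast (by omega : 0 < K)
  have hc0 : 0 < c := by linarith
  have hε2 : 0 < 2 / ε := by positivity
  set A : ℝ := (2 / ε) ^ (Real.log K / ε) with hA
  have hApos : 0 < A := Real.rpow_pos_of_pos hε2 _
  have hball : ∀ (ξ : Boundary K) (n : ℕ),
      ENNReal.ofReal (c⁻¹ * (A * ((K : ℝ) ^ n)⁻¹)) ≤ ν (dyadic (vertexAt ξ (n + 1))) ∧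
      ν (dyadic (vertexAt ξ (n + 1))) ≤ ENNReal.ofReal (c * (A * ((K : ℝ) ^ n)⁻¹)) := by
    intro ξ n
    have hr : 2 / ε * Real.exp (-ε * n) ≤ 2 / ε := by
      refine mul_le_of_le_one_right hε2.le (Real.exp_le_one_iff.2 ?_)
      have : (0 : ℝ) ≤ n := Nat.cast_nonneg n
      nlinarith
    have hQ : (2 / ε * Real.exp (-ε * n)) ^ (Real.log K / ε) = A * ((K : ℝ) ^ n)⁻¹ := by
      rw [Real.mul_rpow hε2.le (Real.exp_pos _).le, ← Real.exp_mul, hA]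
      congr 1
      rw [show -ε * n * (Real.log K / ε) = -(n * Real.log K) by field_simp, Real.exp_neg,
        Real.exp_nat_mul, Real.exp_log hKpos]
    have hset : {ζ | boundaryDist ε ξ ζ < 2 / ε * Real.exp (-ε * n)}
        = dyadic (vertexAt ξ (n + 1)) := by
      ext ζ; exact boundaryDist_lt_iff hε n
    have := h ξ (2 / ε * Real.exp (-ε * n)) (by positivity) hr
    rwa [hset, hQ] at this
  have hroot : dyadic ([] : List (Fin K)) = Set.univ := by ext ξ; simp [dyadic]
  -- every nonempty word is a vertex of some ray
  have hword : ∀ w : List (Fin K), w ≠ [] → ∃ ξ : Boundary K, ∃ n, w = vertexAt ξ (n + 1) := by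
    intro w hw
    have hl : w.length ≠ 0 := by simpa using hw
    refine ⟨fun i => w.getD i ⟨0, by omega⟩, w.length - 1, ?_⟩
    rw [Nat.sub_add_cancel (by omega)]
    refine List.ext_getElem (by simp) fun i h1 h2 => ?_
    simp [vertexAt]
  set M : ℝ≥0 := (c * A * K).toNNReal + (c * A⁻¹).toNNReal + (ν Set.univ).toNNReal with hM
  have hc1 : ENNReal.ofReal (c * A * K) ≤ M := by
    rw [ENNReal.ofReal]
    exact_mod_cast (by rw [hM, add_assoc]; exact le_self_add)
  have hc2 : ENNReal.ofReal (c * A⁻¹) ≤ M := by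
    rw [ENNReal.ofReal]
    exact_mod_cast (by rw [hM, add_right_comm]; exact le_add_self)
  have hc3 : ν Set.univ ≤ M := by
    rw [← ENNReal.coe_toNNReal (measure_ne_top ν Set.univ)]
    exact_mod_cast (by rw [hM]; exact le_add_self)
  have hKE : (K : ℝ≥0∞) = ENNReal.ofReal K := by simp
  have hlow : ∀ (ξ : Boundary K) (n : ℕ),
      1 ≤ M * (K : ℝ≥0∞) ^ n * ν (dyadic (vertexAt ξ (n + 1))) := by
    intro ξ n
    calc (1 : ℝ≥0∞) = ENNReal.ofReal (c * A⁻¹) * (K : ℝ≥0∞) ^ n *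
          ENNReal.ofReal (c⁻¹ * (A * ((K : ℝ) ^ n)⁻¹)) := by
          rw [hKE, ← ENNReal.ofReal_pow hKpos.le, ← ENNReal.ofReal_mul (by positivity),
            ← ENNReal.ofReal_mul (by positivity)]
          rw [← ENNReal.ofReal_one]
          congr 1
          field_simp
      _ ≤ _ := by
          gcongr
          exact (hball ξ n).1
  refine ⟨M, fun w => ?_⟩
  by_cases hw : w = []
  · subst hw
    refine ⟨by simpa [hroot] using hc3, ?_⟩
    refine (hlow (fun _ => ⟨0, by omega⟩) 0).trans ?_
    rw [pow_zero, List.length_nil, pow_zero, hroot]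
    gcongr
    exact Set.subset_univ _
  · obtain ⟨ξ, n, rfl⟩ := hword w hw
    rw [length_vertexAt]
    constructor
    · calc ν (dyadic (vertexAt ξ (n + 1))) * (K : ℝ≥0∞) ^ (n + 1)
          ≤ ENNReal.ofReal (c * (A * ((K : ℝ) ^ n)⁻¹)) * (K : ℝ≥0∞) ^ (n + 1) := by
            gcongr; exact (hball ξ n).2
        _ = ENNReal.ofReal (c * A * K) := by
            rw [hKE, ← ENNReal.ofReal_pow hKpos.le, ← ENNReal.ofReal_mul (by positivity)]
            congr 1
            rw [pow_succ]
            field_simp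
        _ ≤ M := hc1
    · refine (hlow ξ n).trans ?_
      gcongr
      · exact_mod_cast (by omega : 1 ≤ K)
      · omega

/-! ### Mean values over dyadic sets -/

/-- Jensen's inequality for the mean value over a dyadic set. -/
theorem mean_sub_rpow_le {ν : Measure (Boundary K)} [IsFiniteMeasure ν] {p : ℝ} (hp : 1 ≤ p)
    {f : Boundary K → ℝ} (hf : Integrable f ν) {w : List (Fin K)} (hw : ν (dyadic w) ≠ 0) (a : ℝ) :
    ν (dyadic w) * ENNReal.ofReal |mean ν f w - a| ^ p
      ≤ ∫⁻ ξ in dyadic w, ENNReal.ofReal |f ξ - a| ^ p ∂ν := by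
  have hu : (ν.restrict (dyadic w)) Set.univ = ν (dyadic w) := by simp
  have hne : NeZero (ν.restrict (dyadic w)) := ⟨by simpa using hw⟩
  have hj := ofReal_abs_integral_sub_rpow_le
    (μ := (ν.restrict (dyadic w) Set.univ)⁻¹ • ν.restrict (dyadic w)) hp
    (hf.restrict.smul_measure (by simpa using hw)) a
  rw [lintegral_smul_measure, hu, smul_eq_mul] at hj
  calc ν (dyadic w) * ENNReal.ofReal |mean ν f w - a| ^ p
      ≤ ν (dyadic w) * ((ν (dyadic w))⁻¹ *
        ∫⁻ ξ in dyadic w, ENNReal.ofReal |f ξ - a| ^ p ∂ν) := by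
        refine mul_le_mul' le_rfl ?_
        rw [mean, average, hu]
        exact hj
    _ = _ := by
        rw [← mul_assoc, ENNReal.mul_inv_cancel hw (measure_ne_top _ _), one_mul]

/-- The averaging operator over the dyadic sets of level `n` does not increase the distance in `L^p`
to a function that is constant on each of them. -/
theorem lintegral_mean_sub_rpow_le {ν : Measure (Boundary K)} [IsFiniteMeasure ν] {p : ℝ}
    (hp : 1 ≤ p) {f : Boundary K → ℝ} (hf : Integrable f ν) (hν : ∀ w, ν (dyadic w) ≠ 0) (n : ℕ)
    (a : List (Fin K) → ℝ) :
    ∫⁻ ξ, ENNReal.ofReal |mean ν f (vertexAt ξ n) - a (vertexAt ξ n)| ^ p ∂ν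
      ≤ ∫⁻ ξ, ENNReal.ofReal |f ξ - a (vertexAt ξ n)| ^ p ∂ν := by
  rw [← sum_measure_dyadic_mul ν n fun w => ENNReal.ofReal |mean ν f w - a w| ^ p,
    ← sum_setLIntegral_dyadic ν n]
  refine Finset.sum_le_sum fun w _ => (mean_sub_rpow_le hp hf (hν _) _).trans (le_of_eq ?_)
  refine setLIntegral_congr_fun (measurableSet_dyadic _) fun ξ hξ => ?_
  have := mem_dyadic_iff.1 hξ
  rw [List.length_ofFn] at this
  simp only [this]

theorem dyadicEnergy_eq_tsum_lintegral (ε p θ lam : ℝ) (ν : Measure (Boundary K))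
    (f : Boundary K → ℝ) :
    dyadicEnergy ε p θ lam ν f =
      ∑' m : ℕ, ENNReal.ofReal (Real.exp (ε * ((m : ℝ) + 1) * θ * p) * ((m : ℝ) + 1) ^ lam) *
        ∫⁻ ξ, ENNReal.ofReal |mean ν f (vertexAt ξ (m + 1)) - mean ν f (vertexAt ξ m)| ^ p ∂ν := by
  refine tsum_congr fun m => ?_
  rw [sum_measure_dyadic_mul ν (m + 1)
    fun w => ENNReal.ofReal |mean ν f w - mean ν f w.dropLast| ^ p]
  simp only [dropLast_vertexAt]

/-- The `σ`-algebras generated by the dyadic sets of each level. -/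
def dyadicFiltration (K : ℕ) :
    Filtration ℕ (inferInstance : MeasurableSpace (Boundary K)) where
  seq n := MeasurableSpace.comap (fun ξ : Boundary K => vertexAt ξ n) ⊤
  mono' := by
    intro m n hmn
    rw [← measurable_iff_comap_le]
    have h : (fun ξ : Boundary K => vertexAt ξ m) = List.take m ∘ fun ξ => vertexAt ξ n := by
      ext1 ξ; exact (take_vertexAt ξ hmn).symm
    rw [h]
    exact measurable_from_top.comp (comap_measurable _)
  le' n := measurable_iff_comap_le.1 (measurable_vertexAt n)

theorem iSup_dyadicFiltration :
    ⨆ n, dyadicFiltration K n = (inferInstance : MeasurableSpace (Boundary K)) := by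
  refine le_antisymm (iSup_le fun n => (dyadicFiltration K).le n) ?_
  refine iSup_le fun i => ?_
  refine le_trans ?_ (le_iSup _ (i + 1))
  rintro s ⟨t, -, rfl⟩
  refine ⟨{w | ∃ h : i < w.length, w[i] ∈ t}, trivial, ?_⟩
  ext ξ
  have h : ∀ h : i < (vertexAt ξ (i + 1)).length, (vertexAt ξ (i + 1))[i] = ξ i := fun h => by
    simp only [vertexAt, List.getElem_ofFn]
  constructor
  · rintro ⟨hi, hξ⟩
    rwa [h] at hξ
  · intro hξ
    refine ⟨by simp, ?_⟩
    rwa [h]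

theorem mean_vertexAt_ae_eq_condExp {ν : Measure (Boundary K)} [IsFiniteMeasure ν]
    {f : Boundary K → ℝ} (hf : Integrable f ν) (n : ℕ) :
    (fun ξ => mean ν f (vertexAt ξ n)) =ᵐ[ν] ν[f|dyadicFiltration K n] := by
  have hcomp : (fun ξ => mean ν f (vertexAt ξ n))
      = (fun w : Fin n → Fin K => mean ν f (List.ofFn w)) ∘ fun ξ i => ξ i := rfl
  have hint : Integrable (fun ξ => mean ν f (vertexAt ξ n)) ν := by
    obtain ⟨C, hC⟩ := (Set.finite_range
      fun w : Fin n → Fin K => ‖mean ν f (List.ofFn w)‖).bddAbove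
    refine Integrable.of_bound (C := C) ?_ (ae_of_all _ fun ξ => hC ⟨fun i => ξ i, rfl⟩)
    exact ((measurable_of_countable (mean ν f)).comp (measurable_vertexAt n)).aestronglyMeasurable
  refine ae_eq_condExp_of_forall_setIntegral_eq ((dyadicFiltration K).le n) hf
    (fun s _ _ => hint.integrableOn) ?_ ?_
  · rintro s ⟨A, -, rfl⟩ -
    classical
    have hs : (fun ξ : Boundary K => vertexAt ξ n) ⁻¹' A
        = ⋃ w ∈ Finset.univ.filter (fun w : Fin n → Fin K => List.ofFn w ∈ A),
          dyadic (List.ofFn w) := by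
      ext ξ
      simp [mem_dyadic_ofFn, vertexAt]
    rw [hs, integral_biUnion_finset _ (fun w _ => measurableSet_dyadic _)
      (fun v _ w _ hvw => pairwise_disjoint_dyadic n hvw) (fun w _ => hint.integrableOn),
      integral_biUnion_finset _ (fun w _ => measurableSet_dyadic _)
      (fun v _ w _ hvw => pairwise_disjoint_dyadic n hvw) (fun w _ => hf.integrableOn)]
    refine Finset.sum_congr rfl fun w _ => ?_
    rw [setIntegral_congr_fun (g := fun _ => mean ν f (List.ofFn w)) (measurableSet_dyadic _),
      setIntegral_const, mean, measure_smul_setAverage _ (measure_ne_top _ _)]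
    intro ξ hξ
    have := mem_dyadic_iff.1 hξ
    rw [List.length_ofFn] at this
    simp only [this]
  · refine Measurable.aestronglyMeasurable ?_
    exact (measurable_of_countable (mean ν f)).comp
      (comap_measurable fun ξ : Boundary K => vertexAt ξ n)

/-- Lebesgue's differentiation theorem for dyadic sets, as a case of martingale convergence. -/
theorem tendsto_mean_vertexAt {ν : Measure (Boundary K)} [IsFiniteMeasure ν]
    {f : Boundary K → ℝ} (hf : Integrable f ν) :
    ∀ᵐ ξ ∂ν, Tendsto (fun n => mean ν f (vertexAt ξ n)) atTop (𝓝 (f ξ)) := by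
  have h1 := tendsto_ae_condExp (μ := ν) (ℱ := dyadicFiltration K) f
  have h2 : ν[f|⨆ n, dyadicFiltration K n] =ᵐ[ν] f := by
    refine condExp_of_aestronglyMeasurable' (iSup_le fun n => (dyadicFiltration K).le n) ?_ hf
    rw [iSup_dyadicFiltration]
    exact hf.aestronglyMeasurable
  filter_upwards [h1, h2, ae_all_iff.2 fun n => mean_vertexAt_ae_eq_condExp hf n]
    with ξ h1 h2 h3
  rw [← h2]
  simpa only [h3] using h1

/-! ### Edges of the tree -/

/-- The half-open edge from the parent of `w` to `w`, which contains `w`; for the empty word it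
consists of the root only. -/
def edge (w : List (Fin K)) : Set (Pt K) := {x | x.word = w}

theorem Pt.height_nonneg (x : Pt K) : 0 ≤ x.height := x.2.1

theorem Pt.length_word (x : Pt K) : x.word.length = ⌈x.height⌉₊ := x.2.2

theorem Pt.height_le (x : Pt K) : x.height ≤ x.word.length := by
  rw [x.length_word]; exact Nat.le_ceil _

theorem Pt.lt_height {x : Pt K} {n : ℕ} (h : n < x.word.length) : (n : ℝ) < x.height := by
  rw [x.length_word] at h; exact Nat.lt_ceil.1 h

@[simp] theorem word_vertex (w : List (Fin K)) : (vertex w).word = w := rfl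

@[simp] theorem height_vertex (w : List (Fin K)) : (vertex w).height = w.length := rfl

theorem Pt.ext' {x y : Pt K} (h : x.height = y.height) (hw : x.word = y.word) : x = y :=
  Subtype.ext (Prod.ext h hw)

theorem Pt.eq_vertex_of_le {x : Pt K} (h : (x.word.length : ℝ) ≤ x.height) :
    x = vertex x.word :=
  Pt.ext' (le_antisymm x.height_le h) rfl

theorem cast_length_dropLast {w : List (Fin K)} (hw : w ≠ []) :
    ((w.dropLast.length : ℕ) : ℝ) = w.length - 1 := by
  have : 1 ≤ w.length := List.length_pos_iff.2 hw
  rw [List.length_dropLast, Nat.cast_sub this, Nat.cast_one]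

theorem lt_height_of_mem_edge {w : List (Fin K)} (hw : w ≠ []) {x : Pt K} (hx : x ∈ edge w) :
    (w.length : ℝ) - 1 < x.height := by
  have hx : x.word = w := hx
  have h1 : 0 < w.length := List.length_pos_iff.2 hw
  rw [← cast_length_dropLast hw]
  refine Pt.lt_height ?_
  rw [List.length_dropLast, hx]
  omega

theorem height_le_of_mem_edge {w : List (Fin K)} {x : Pt K} (hx : x ∈ edge w) :
    x.height ≤ w.length := by
  have hx : x.word = w := hx
  simpa [hx] using x.height_le

theorem measurable_height : Measurable (Pt.height : Pt K → ℝ) :=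
  measurable_fst.comp measurable_subtype_coe

theorem measurable_word : Measurable (Pt.word : Pt K → List (Fin K)) :=
  measurable_snd.comp measurable_subtype_coe

theorem measurableSet_edge (w : List (Fin K)) : MeasurableSet (edge w) :=
  measurable_word (MeasurableSpace.measurableSet_top (s := {w}))

theorem measurableEmbedding_height_word :
    MeasurableEmbedding fun x : Pt K => (x.height, x.word) := by
  have h : MeasurableSet {x : ℝ × List (Fin K) | 0 ≤ x.1 ∧ x.2.length = ⌈x.1⌉₊} := by
    refine (measurableSet_le measurable_const measurable_fst).inter
      (measurableSet_eq_fun ?_ ?_)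
    · exact (measurable_of_countable List.length).comp measurable_snd
    · exact Nat.measurable_ceil.comp measurable_fst
  exact MeasurableEmbedding.subtype_coe h

theorem lengthMeasure_edge_inter {w : List (Fin K)} (hw : w ≠ []) (A : Set ℝ) :
    lengthMeasure K (edge w ∩ Pt.height ⁻¹' A) =
      volume (A ∩ Set.Ioc ((w.length : ℝ) - 1) w.length) := by
  rw [lengthMeasure, measurableEmbedding_height_word.comap_apply]
  have h1 : 0 < w.length := List.length_pos_iff.2 hw
  have himg : (fun x : Pt K => (x.height, x.word)) '' (edge w ∩ Pt.height ⁻¹' A)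
      = (A ∩ Set.Ioc ((w.length : ℝ) - 1) w.length) ×ˢ {w} := by
    ext ⟨s, v⟩
    constructor
    · rintro ⟨x, ⟨hx, hxA⟩, heq⟩
      have hs : x.height = s := congrArg Prod.fst heq
      have hv : x.word = v := congrArg Prod.snd heq
      subst hs hv
      exact ⟨⟨hxA, lt_height_of_mem_edge hw hx, height_le_of_mem_edge hx⟩, hx⟩
    · rintro ⟨⟨hsA, hs1, hs2⟩, hv⟩
      have hv : v = w := hv
      subst hv
      have h0 : (1 : ℝ) ≤ v.length := by exact_mod_cast h1
      refine ⟨⟨(s, v), ?_, ?_⟩, ⟨rfl, hsA⟩, rfl⟩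
      · change 0 ≤ s
        change (v.length : ℝ) - 1 < s at hs1
        linarith
      · change v.length = ⌈s⌉₊
        refine ((Nat.ceil_eq_iff h1.ne').2 ⟨?_, hs2⟩).symm
        rw [Nat.cast_sub h1, Nat.cast_one]
        exact hs1
  rw [himg, Measure.prod_prod, Measure.count_singleton, mul_one]

theorem lengthMeasure_edge_nil : lengthMeasure K (edge []) = 0 := by
  rw [lengthMeasure, measurableEmbedding_height_word.comap_apply]
  refine measure_mono_null (t := {0} ×ˢ Set.univ) ?_ (by simp [Measure.prod_prod])
  rintro _ ⟨x, hx, rfl⟩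
  refine ⟨?_, trivial⟩
  have := height_le_of_mem_edge hx
  exact le_antisymm (by simpa using this) x.height_nonneg

theorem lengthMeasure_edge {w : List (Fin K)} (hw : w ≠ []) : lengthMeasure K (edge w) = 1 := by
  have := lengthMeasure_edge_inter hw Set.univ
  simpa using this

theorem lengthMeasure_singleton (x : Pt K) : lengthMeasure K {x} = 0 := by
  by_cases hw : x.word = []
  · refine measure_mono_null ?_ lengthMeasure_edge_nil
    rintro y rfl
    exact hw
  · have h := lengthMeasure_edge_inter hw {x.height}
    refine measure_mono_null ?_ (h.trans (measure_mono_null Set.inter_subset_left (by simp)))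
    rintro y rfl
    exact ⟨rfl, rfl⟩

theorem map_height_restrict_edge {w : List (Fin K)} (hw : w ≠ []) :
    ((lengthMeasure K).restrict (edge w)).map Pt.height
      = volume.restrict (Set.Ioc ((w.length : ℝ) - 1) w.length) := by
  ext A hA
  rw [Measure.map_apply measurable_height hA, Measure.restrict_apply (measurable_height hA),
    Set.inter_comm, lengthMeasure_edge_inter hw A, Measure.restrict_apply hA]

theorem arcLength_null {ε : ℝ} {S : Set (Pt K)} (h : lengthMeasure K S = 0) :
    arcLength K ε S = 0 :=
  withDensity_absolutelyContinuous _ _ h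

theorem measurable_density (ε : ℝ) :
    Measurable fun x : Pt K => ENNReal.ofReal (Real.exp (-ε * x.height)) :=
  (Real.measurable_exp.comp (measurable_height.const_mul _)).ennreal_ofReal

theorem arcLength_edge_inter_Ioc {ε : ℝ} (hε : 0 < ε) {w : List (Fin K)} (hw : w ≠ []) {a b : ℝ}
    (ha : (w.length : ℝ) - 1 ≤ a) (hab : a ≤ b) (hb : b ≤ w.length) :
    arcLength K ε (edge w ∩ Pt.height ⁻¹' Set.Ioc a b)
      = ENNReal.ofReal ((Real.exp (-ε * a) - Real.exp (-ε * b)) / ε) := by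
  have hm : MeasurableSet (Pt.height ⁻¹' Set.Ioc a b : Set (Pt K)) :=
    measurable_height measurableSet_Ioc
  rw [arcLength, withDensity_apply _ ((measurableSet_edge w).inter hm), Set.inter_comm,
    ← Measure.restrict_restrict hm,
    ← setLIntegral_map (f := fun s => ENNReal.ofReal (Real.exp (-ε * s))) measurableSet_Ioc
      (by fun_prop) measurable_height, map_height_restrict_edge hw,
    Measure.restrict_restrict measurableSet_Ioc, Set.inter_eq_left.2 (Set.Ioc_subset_Ioc ha hb),
    ← ofReal_integral_eq_lintegral_ofReal, ← intervalIntegral.integral_of_le hab]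
  · congr 1
    have hd : ∀ x ∈ Set.uIcc a b,
        HasDerivAt (fun s => -Real.exp (-ε * s) / ε) (Real.exp (-ε * x)) x := by
      intro x _
      have h1 : HasDerivAt (fun s => -ε * s) (-ε) x := by
        simpa using (hasDerivAt_id x).const_mul (-ε)
      exact ((h1.exp.neg).div_const ε).congr_deriv (by rw [div_eq_iff hε.ne']; ring)
    rw [intervalIntegral.integral_eq_sub_of_hasDerivAt hd
      (Continuous.intervalIntegrable (by fun_prop) _ _)]
    ring
  · exact Continuous.integrableOn_Ioc (by fun_prop)
  · exact ae_of_all _ fun s => (Real.exp_pos _).le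

/-! ### Geodesics -/

theorem Pt.Le.refl (x : Pt K) : x.Le x := ⟨le_rfl, List.prefix_rfl⟩

theorem Pt.Le.trans {x y z : Pt K} (h : x.Le y) (h' : y.Le z) : x.Le z :=
  ⟨h.1.trans h'.1, h.2.trans h'.2⟩

theorem geodesic_of_le {x y : Pt K} (h : x.Le y) : geodesic x y = {z | x.Le z ∧ z.Le y} := by
  ext z
  constructor
  · rintro ⟨hz, ha⟩
    exact ⟨ha x (Pt.Le.refl x) h, hz.elim (fun hz => hz.trans h) id⟩
  · rintro ⟨h1, h2⟩
    exact ⟨Or.inr h2, fun a hax _ => hax.trans h1⟩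

theorem vertex_dropLast_le (x : Pt K) : (vertex x.word.dropLast).Le x := by
  refine ⟨?_, List.dropLast_prefix _⟩
  by_cases hw : x.word = []
  · simpa [hw] using x.height_nonneg
  · rw [height_vertex, cast_length_dropLast hw]
    exact (lt_height_of_mem_edge hw rfl).le

theorem le_vertex_word (x : Pt K) : x.Le (vertex x.word) := ⟨x.height_le, List.prefix_rfl⟩

theorem prefix_dropLast {v w : List (Fin K)} (h : v <+: w) (hne : v ≠ w) : v <+: w.dropLast := by
  have hl : v.length < w.length :=
    lt_of_le_of_ne h.length_le fun hl => hne (h.eq_of_length hl)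
  rw [List.dropLast_eq_take, List.prefix_take_iff]
  exact ⟨h, by omega⟩

theorem le_vertex_dropLast {x y : Pt K} (h : x.Le y) (hne : x.word ≠ y.word) :
    x.Le (vertex y.word.dropLast) := by
  have hp := prefix_dropLast h.2 hne
  exact ⟨x.height_le.trans (Nat.cast_le.2 hp.length_le), hp⟩

theorem geodesic_vertex_dropLast_subset (x : Pt K) :
    geodesic (vertex x.word.dropLast) x ⊆
      {vertex x.word.dropLast} ∪
        (edge x.word ∩ Pt.height ⁻¹' Set.Ioc ((x.word.length : ℝ) - 1) x.height) := by
  rw [geodesic_of_le (vertex_dropLast_le x)]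
  rintro z ⟨h1, h2⟩
  by_cases hz : z.word = x.word
  · by_cases hw : x.word = []
    · refine Or.inl (Pt.ext' (le_antisymm ?_ h1.1) (by simp [hz, hw]))
      have := z.height_le
      simpa [hz, hw] using this
    · refine Or.inr ⟨hz, ?_, h2.1⟩
      have := lt_height_of_mem_edge (w := z.word) (by rwa [hz]) rfl
      rwa [hz] at this
  · left
    have hzw : z.word = x.word.dropLast :=
      (prefix_dropLast h2.2 hz).eq_of_length_le h1.2.length_le
    have := Pt.eq_vertex_of_le (x := z) (by rw [hzw]; exact h1.1)
    rw [hzw] at this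
    exact this

theorem geodesic_vertex_word_subset (x : Pt K) : geodesic x (vertex x.word) ⊆ edge x.word := by
  rw [geodesic_of_le (le_vertex_word x)]
  rintro z ⟨h1, h2⟩
  exact (h2.2.eq_of_length_le h1.2.length_le)

/-- The part of the geodesic from `x` down to `y` below `x`. -/
def segment (x y : Pt K) : Set (Pt K) := {z | x.Le z ∧ z.Le y ∧ x.height < z.height}

theorem measurableSet_segment (x y : Pt K) : MeasurableSet (segment x y) := by
  have h : segment x y = (Pt.height ⁻¹' Set.Icc x.height y.height ∩
      Pt.word ⁻¹' {w | x.word <+: w ∧ w <+: y.word}) ∩ Pt.height ⁻¹' Set.Ioi x.height := by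
    ext z
    simp only [segment, Pt.Le, Set.mem_ofPred_eq, Set.mem_inter_iff, Set.mem_preimage,
      Set.mem_Icc, Set.mem_Ioi]
    tauto
  rw [h]
  exact ((measurable_height measurableSet_Icc).inter
    (measurable_word MeasurableSpace.measurableSet_top)).inter (measurable_height measurableSet_Ioi)

theorem edge_inter_subset_segment {x y : Pt K} (h : x.Le y) :
    edge y.word ∩ Pt.height ⁻¹' Set.Ioc x.height y.height ⊆ segment x y := by
  rintro z ⟨hz, h1, h2⟩
  have hz : z.word = y.word := hz
  exact ⟨⟨h1.le, hz ▸ h.2⟩, ⟨h2, hz ▸ List.prefix_rfl⟩, h1⟩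

theorem segment_union {x y z : Pt K} (h : x.Le y) (h' : y.Le z) :
    segment x y ∪ segment y z ⊆ segment x z := by
  rintro a (⟨h1, h2, h3⟩ | ⟨h1, h2, h3⟩)
  · exact ⟨h1, h2.trans h', h3⟩
  · exact ⟨h.trans h1, h2, h.1.trans_lt h3⟩

theorem disjoint_segment (x y z : Pt K) : Disjoint (segment x y) (segment y z) :=
  Set.disjoint_left.2 fun _ ha hb => absurd hb.2.2 (not_lt.2 ha.2.1.1)

theorem exists_longest_common_prefix (v w : List (Fin K)) :
    ∃ l, l <+: v ∧ l <+: w ∧ ∀ a, a <+: v → a <+: w → a <+: l := by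
  induction v generalizing w with
  | nil => exact ⟨[], List.nil_prefix, List.nil_prefix, fun a h _ => h⟩
  | cons i v ih =>
    rcases w with _ | ⟨j, w⟩
    · exact ⟨[], List.nil_prefix, List.nil_prefix, fun a _ h => h⟩
    · by_cases hij : i = j
      · subst hij
        obtain ⟨l, h1, h2, h3⟩ := ih w
        refine ⟨i :: l, by simpa using h1, by simpa using h2, fun a ha hb => ?_⟩
        rcases a with _ | ⟨k, a⟩
        · exact List.nil_prefix
        · rw [List.cons_prefix_cons] at ha hb ⊢
          exact ⟨ha.1, h3 a ha.2 hb.2⟩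
      · refine ⟨[], List.nil_prefix, List.nil_prefix, fun a ha hb => ?_⟩
        rcases a with _ | ⟨k, a⟩
        · exact List.nil_prefix
        · rw [List.cons_prefix_cons] at ha hb
          exact absurd (ha.1.symm.trans hb.1) hij

/-- Any two points have a last common ancestor. -/
theorem exists_meet (x y : Pt K) :
    ∃ m : Pt K, m.Le x ∧ m.Le y ∧ ∀ a : Pt K, a.Le x → a.Le y → a.Le m := by
  obtain ⟨l, hx, hy, hl⟩ := exists_longest_common_prefix x.word y.word
  set h : ℝ := min (min x.height y.height) l.length with hh
  have h0 : 0 ≤ h := le_min (le_min x.height_nonneg y.height_nonneg) (Nat.cast_nonneg _)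
  have hc : ⌈h⌉₊ ≤ l.length := Nat.ceil_le.2 (min_le_right _ _)
  refine ⟨⟨(h, l.take ⌈h⌉₊), h0, by simpa using hc⟩,
    ⟨(min_le_left _ _).trans (min_le_left _ _), (List.take_prefix _ _).trans hx⟩,
    ⟨(min_le_left _ _).trans (min_le_right _ _), (List.take_prefix _ _).trans hy⟩,
    fun a hax hay => ?_⟩
  have hal := hl _ hax.2 hay.2
  have hah : a.height ≤ h :=
    le_min (le_min hax.1 hay.1) (a.height_le.trans (by exact_mod_cast hal.length_le))
  refine ⟨hah, ?_⟩
  change a.word <+: l.take ⌈h⌉₊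
  rw [List.prefix_take_iff]
  exact ⟨hal, by rw [a.length_word]; exact Nat.ceil_le_ceil hah⟩

/-- On a tree it suffices to test upper gradients on vertical segments inside one edge. -/
theorem isUpperGradient_of_edge {ε : ℝ} {u : Pt K → ℝ} {g : Pt K → ℝ≥0∞} (hg : Measurable g)
    (h : ∀ x y : Pt K, x.Le y → (x.word = y.word ∨ x = vertex y.word.dropLast) →
      ENNReal.ofReal |u y - u x| ≤ ∫⁻ z in segment x y, g z ∂(arcLength K ε)) :
    IsUpperGradient ε u g := by
  have habs : ∀ a b c : ℝ, ENNReal.ofReal |a - c| ≤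
      ENNReal.ofReal |a - b| + ENNReal.ofReal |b - c| := fun a b c => by
    rw [← ENNReal.ofReal_add (abs_nonneg _) (abs_nonneg _)]
    exact ENNReal.ofReal_le_ofReal (abs_sub_le _ _ _)
  have hvert : ∀ (n : ℕ) (x y : Pt K), y.word.length = n → x.Le y →
      ENNReal.ofReal |u y - u x| ≤ ∫⁻ z in segment x y, g z ∂(arcLength K ε) := by
    intro n
    induction n with
    | zero =>
      intro x y hn hxy
      refine h x y hxy (Or.inl ?_)
      have hy : y.word = [] := List.length_eq_zero_iff.1 hn
      rw [hy]
      exact List.prefix_nil.1 (hy ▸ hxy.2)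
    | succ n ih =>
      intro x y hn hxy
      by_cases hw : x.word = y.word
      · exact h x y hxy (Or.inl hw)
      · have h1 := le_vertex_dropLast hxy hw
        have h2 := vertex_dropLast_le y
        calc ENNReal.ofReal |u y - u x|
            ≤ ENNReal.ofReal |u (vertex y.word.dropLast) - u x| +
              ENNReal.ofReal |u y - u (vertex y.word.dropLast)| := by
              rw [add_comm]; exact habs _ _ _
          _ ≤ ∫⁻ z in segment x (vertex y.word.dropLast), g z ∂(arcLength K ε) +
              ∫⁻ z in segment (vertex y.word.dropLast) y, g z ∂(arcLength K ε) :=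
              add_le_add (ih _ _ (by simp [hn]) h1) (h _ _ h2 (Or.inr rfl))
          _ = ∫⁻ z in segment x (vertex y.word.dropLast) ∪ segment (vertex y.word.dropLast) y,
              g z ∂(arcLength K ε) :=
              (lintegral_union (measurableSet_segment _ _) (disjoint_segment _ _ _)).symm
          _ ≤ _ := lintegral_mono_set (segment_union h1 h2)
  refine ⟨hg, fun x y => ?_⟩
  obtain ⟨m, hx, hy, hm⟩ := exists_meet x y
  have hdisj : Disjoint (segment m x) (segment m y) :=
    Set.disjoint_left.2 fun a ha hb => absurd ha.2.2 (not_lt.2 (hm a ha.2.1 hb.2.1).1)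
  have hsub : segment m x ∪ segment m y ⊆ geodesic x y := by
    rintro a (⟨h1, h2, -⟩ | ⟨h1, h2, -⟩)
    · exact ⟨Or.inl h2, fun b hbx hby => (hm b hbx hby).trans h1⟩
    · exact ⟨Or.inr h2, fun b hbx hby => (hm b hbx hby).trans h1⟩
  calc ENNReal.ofReal |u x - u y|
      ≤ ENNReal.ofReal |u x - u m| + ENNReal.ofReal |u y - u m| := by
        rw [abs_sub_comm (u y)]; exact habs _ _ _
    _ ≤ _ := add_le_add (hvert _ _ _ rfl hx) (hvert _ _ _ rfl hy)
    _ = ∫⁻ z in segment m x ∪ segment m y, g z ∂(arcLength K ε) :=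
        (lintegral_union (measurableSet_segment _ _) hdisj).symm
    _ ≤ _ := lintegral_mono_set hsub

theorem treeDist_vertex_dropLast {ε : ℝ} (hε : 0 < ε) {x : Pt K} (hx : x.word ≠ []) :
    treeDist ε (vertex x.word.dropLast) x
      = (Real.exp (-ε * ((x.word.length : ℝ) - 1)) - Real.exp (-ε * x.height)) / ε := by
  have hlt := lt_height_of_mem_edge hx rfl
  have hle := vertex_dropLast_le x
  have harc : arcLength K ε (geodesic (vertex x.word.dropLast) x) = ENNReal.ofReal
      ((Real.exp (-ε * ((x.word.length : ℝ) - 1)) - Real.exp (-ε * x.height)) / ε) := by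
    rw [← arcLength_edge_inter_Ioc hε hx le_rfl hlt.le x.height_le]
    refine le_antisymm ?_ (measure_mono ?_)
    · refine (measure_mono (geodesic_vertex_dropLast_subset x)).trans
        ((measure_union_le _ _).trans (le_of_eq ?_))
      rw [arcLength_null (lengthMeasure_singleton _), zero_add]
    · rw [geodesic_of_le hle]
      have := edge_inter_subset_segment hle
      rw [height_vertex, cast_length_dropLast hx] at this
      exact this.trans fun z hz => ⟨hz.1, hz.2.1⟩
  have hmeas : MeasurableSet (geodesic (vertex x.word.dropLast) x) := by
    rw [geodesic_of_le hle]
    have h : {z | (vertex x.word.dropLast).Le z ∧ z.Le x} =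
        Pt.height ⁻¹' Set.Icc (vertex x.word.dropLast).height x.height ∩
        Pt.word ⁻¹' {w | x.word.dropLast <+: w ∧ w <+: x.word} := by
      ext z
      simp only [Pt.Le, Set.mem_ofPred_eq, Set.mem_inter_iff, Set.mem_preimage, Set.mem_Icc,
        word_vertex]
      tauto
    rw [h]
    exact (measurable_height measurableSet_Icc).inter
      (measurable_word MeasurableSpace.measurableSet_top)
  rw [treeDist, integral_eq_lintegral_of_nonneg_ae (ae_of_all _ fun z => (Real.exp_pos _).le)
    (Real.measurable_exp.comp (measurable_height.const_mul _)).aestronglyMeasurable,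
    ← withDensity_apply _ hmeas]
  change (arcLength K ε _).toReal = _
  rw [harc, ENNReal.toReal_ofReal]
  refine div_nonneg (sub_nonneg.2 (Real.exp_le_exp.2 ?_)) hε.le
  nlinarith

/-! ### Summation over the edges -/

theorem tsum_list_eq {φ : List (Fin K) → ℝ≥0∞} (h0 : φ [] = 0) :
    ∑' w, φ w = ∑' m : ℕ, ∑ w : Fin (m + 1) → Fin K, φ (List.ofFn w) := by
  rw [← List.equivSigmaTuple.symm.tsum_eq, 
    ENNReal.tsum_sigma fun n w => φ (List.equivSigmaTuple.symm ⟨n, w⟩), tsum_eq_zero_add' ENNReal.summable]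
  have h1 : ∑' w : Fin 0 → Fin K, φ (List.equivSigmaTuple.symm ⟨0, w⟩) = 0 := by
    refine ENNReal.tsum_eq_zero.2 fun w => ?_
    simpa [List.equivSigmaTuple] using h0
  rw [h1, zero_add]
  refine tsum_congr fun m => ?_
  rw [tsum_fintype]
  rfl

theorem lintegral_eq_tsum_edge {μ : Measure (Pt K)} (hμ : μ ≪ lengthMeasure K)
    (h : Pt K → ℝ≥0∞) :
    ∫⁻ x, h x ∂μ = ∑' m : ℕ, ∑ w : Fin (m + 1) → Fin K, ∫⁻ x in edge (List.ofFn w), h x ∂μ := by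
  rw [← tsum_list_eq (φ := fun w => ∫⁻ x in edge w, h x ∂μ)
    (setLIntegral_measure_zero _ _ (hμ lengthMeasure_edge_nil)),
    ← lintegral_iUnion measurableSet_edge, Set.iUnion_eq_univ_iff.2 fun x => ⟨x.word, rfl⟩,
    Measure.restrict_univ]
  intro v w hvw
  exact Set.disjoint_left.2 fun x hv hw => hvw (Eq.trans (Eq.symm hv) hw)

/-! ### The weights of the levels -/

/-- The order of magnitude of the density of `μ_λ` on an edge ending at height `m + 1`. -/
noncomputable def edgeWeight (β lam : ℝ) (m : ℕ) : ℝ≥0∞ :=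
  ENNReal.ofReal (Real.exp (-(β * ((m : ℝ) + 1))) * ((m : ℝ) + 1) ^ lam)

/-- The weight of the level `m + 1` in the dyadic energy. -/
noncomputable def besovWeight (ε p θ lam : ℝ) (m : ℕ) : ℝ≥0∞ :=
  ENNReal.ofReal (Real.exp (ε * ((m : ℝ) + 1) * θ * p) * ((m : ℝ) + 1) ^ lam)

theorem edgeWeight_ne_top (β lam : ℝ) (m : ℕ) : edgeWeight β lam m ≠ ∞ := ENNReal.ofReal_ne_top

theorem edgeWeight_ne_zero (β lam : ℝ) (m : ℕ) : edgeWeight β lam m ≠ 0 :=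
  (ENNReal.ofReal_pos.2 (by positivity)).ne'

theorem besovWeight_ne_top (ε p θ lam : ℝ) (m : ℕ) : besovWeight ε p θ lam m ≠ ∞ :=
  ENNReal.ofReal_ne_top

theorem besovWeight_ne_zero (ε p θ lam : ℝ) (m : ℕ) : besovWeight ε p θ lam m ≠ 0 :=
  (ENNReal.ofReal_pos.2 (by positivity)).ne'

/-- This identity between the weights is what determines the smoothness exponent `θ`. -/
theorem besovWeight_eq {β ε lam p θ : ℝ} (hK : 2 ≤ K)
    (hθ : ε * θ * p = ε * p - (β - Real.log K)) (m : ℕ) :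
    besovWeight ε p θ lam m =
      edgeWeight β lam m * ENNReal.ofReal (Real.exp (ε * p * ((m : ℝ) + 1))) *
        (K : ℝ≥0∞) ^ (m + 1) := by
  have hKpos : (0 : ℝ) < K := by exact_mod_cast (by omega : 0 < K)
  rw [show (K : ℝ≥0∞) = ENNReal.ofReal K by simp, ← ENNReal.ofReal_pow hKpos.le, edgeWeight,
    besovWeight, ← ENNReal.ofReal_mul (by positivity), ← ENNReal.ofReal_mul (by positivity)]
  congr 1
  have h : (K : ℝ) ^ (m + 1) = Real.exp (((m : ℝ) + 1) * Real.log K) := by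
    rw [← Real.exp_log (pow_pos hKpos (m + 1)), Real.log_pow]; push_cast; rfl
  rw [h, show ε * ((m : ℝ) + 1) * θ * p = -(β * ((m : ℝ) + 1)) + ε * p * ((m : ℝ) + 1) +
    ((m : ℝ) + 1) * Real.log K by linear_combination ((m : ℝ) + 1) * hθ, Real.exp_add, Real.exp_add]
  ring

theorem tsum_edgeWeight_mul_ne_top {β : ℝ} (hK : 2 ≤ K) (hβ : Real.log K < β) (lam : ℝ) :
    ∑' m, edgeWeight β lam m * (K : ℝ≥0∞) ^ (m + 1) ≠ ∞ := by
  have hKpos : (0 : ℝ) < K := by exact_mod_cast (by omega : 0 < K)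
  convert (summable_exp_mul_rpow (sub_pos.2 hβ) lam).tsum_ofReal_ne_top using 3 with m
  rw [show (K : ℝ≥0∞) = ENNReal.ofReal K by simp, ← ENNReal.ofReal_pow hKpos.le, edgeWeight,
    ← ENNReal.ofReal_mul (by positivity)]
  congr 1
  have h : (K : ℝ) ^ (m + 1) = Real.exp (((m : ℝ) + 1) * Real.log K) := by
    rw [← Real.exp_log (pow_pos hKpos (m + 1)), Real.log_pow]; push_cast; rfl
  rw [h, mul_right_comm, ← Real.exp_add]
  congr 2
  ring

theorem density_le_and_le {β C : ℝ} (hβ : 0 < β) (hC : 0 < C) (lam : ℝ) {m : ℕ} {s : ℝ}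
    (hs : (m : ℝ) < s) (hsm : s ≤ m + 1) :
    Real.exp (-β * s) * (s + C) ^ lam ≤ Real.exp β * (max (1 + C) C⁻¹) ^ |lam| *
      (Real.exp (-(β * ((m : ℝ) + 1))) * ((m : ℝ) + 1) ^ lam) ∧
    Real.exp (-(β * ((m : ℝ) + 1))) * ((m : ℝ) + 1) ^ lam ≤
      Real.exp β * (max (1 + C) C⁻¹) ^ |lam| * (Real.exp (-β * s) * (s + C) ^ lam) := by
  have hm : (0 : ℝ) ≤ m := Nat.cast_nonneg m
  set κ := max (1 + C) C⁻¹ with hκdef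
  have hκ1 : 1 + C ≤ κ := le_max_left _ _
  have hκ : 1 ≤ κ := by linarith
  have hκC : κ⁻¹ ≤ C := inv_le_of_inv_le₀ hC (le_max_right _ _)
  have hκi : κ⁻¹ ≤ 1 := inv_le_one_of_one_le₀ hκ
  have hsC : 0 < s + C := by linarith
  have h1 : κ⁻¹ * ((m : ℝ) + 1) ≤ s + C := by nlinarith
  have h2 : s + C ≤ κ * ((m : ℝ) + 1) := by nlinarith
  have hm1 : 0 < (m : ℝ) + 1 := by linarith
  have hκ0 : 0 < κ := by linarith
  have r1 : (s + C) ^ lam ≤ κ ^ |lam| * ((m : ℝ) + 1) ^ lam := by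
    have := rpow_le_rpow_abs (r := (s + C) / ((m : ℝ) + 1)) hκ
      ((le_div_iff₀ hm1).2 h1) ((div_le_iff₀ hm1).2 h2) lam
    rwa [Real.div_rpow hsC.le hm1.le, div_le_iff₀ (Real.rpow_pos_of_pos hm1 _)] at this
  have r2 : ((m : ℝ) + 1) ^ lam ≤ κ ^ |lam| * (s + C) ^ lam := by
    have := rpow_le_rpow_abs (r := ((m : ℝ) + 1) / (s + C)) hκ
      ((le_div_iff₀ hsC).2 ((inv_mul_le_iff₀ hκ0).2 h2))
      ((div_le_iff₀ hsC).2 ((inv_mul_le_iff₀ hκ0).1 h1)) lam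
    rwa [Real.div_rpow hm1.le hsC.le, div_le_iff₀ (Real.rpow_pos_of_pos hsC _)] at this
  have e1 : Real.exp (-β * s) ≤ Real.exp β * Real.exp (-(β * ((m : ℝ) + 1))) := by
    rw [← Real.exp_add]; exact Real.exp_le_exp.2 (by nlinarith)
  have e2 : Real.exp (-(β * ((m : ℝ) + 1))) ≤ Real.exp β * Real.exp (-β * s) := by
    rw [← Real.exp_add]; exact Real.exp_le_exp.2 (by nlinarith)
  constructor
  · calc _ ≤ (Real.exp β * Real.exp (-(β * ((m : ℝ) + 1)))) * (κ ^ |lam| * ((m : ℝ) + 1) ^ lam) :=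
          mul_le_mul e1 r1 (by positivity) (by positivity)
      _ = _ := by ring
  · calc _ ≤ (Real.exp β * Real.exp (-β * s)) * (κ ^ |lam| * (s + C) ^ lam) :=
          mul_le_mul e2 r2 (by positivity) (by positivity)
      _ = _ := by ring

theorem weightedMeasure_absolutelyContinuous (β lam C : ℝ) :
    weightedMeasure K β lam C ≪ lengthMeasure K :=
  withDensity_absolutelyContinuous _ _

/-- On an edge, `μ_λ` is comparable to a multiple of the length measure. -/
theorem exists_setLIntegral_edge_comparable (K : ℕ) {β C : ℝ} (hβ : 0 < β) (hC : 0 < C) (lam : ℝ) :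
    ∃ c : ℝ≥0∞, c ≠ ∞ ∧ ∀ (m : ℕ) (w : List (Fin K)), w.length = m + 1 → ∀ h : Pt K → ℝ≥0∞,
      Measurable h →
      ∫⁻ x in edge w, h x ∂(weightedMeasure K β lam C) ≤
        c * edgeWeight β lam m * ∫⁻ x in edge w, h x ∂(lengthMeasure K) ∧
      edgeWeight β lam m * ∫⁻ x in edge w, h x ∂(lengthMeasure K) ≤
        c * ∫⁻ x in edge w, h x ∂(weightedMeasure K β lam C) := by
  refine ⟨ENNReal.ofReal (Real.exp β * (max (1 + C) C⁻¹) ^ |lam|), ENNReal.ofReal_ne_top,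
    fun m w hw h hh => ?_⟩
  have hc0 : 0 ≤ Real.exp β * (max (1 + C) C⁻¹) ^ |lam| := by positivity
  have hd : Measurable fun x : Pt K =>
      ENNReal.ofReal (Real.exp (-β * x.height) * (x.height + C) ^ lam) :=
    ((Real.measurable_exp.comp (measurable_height.const_mul _)).mul
      ((measurable_height.add_const C).pow_const lam)).ennreal_ofReal
  have hne : w ≠ [] := by rintro rfl; simp at hw
  have hx : ∀ x ∈ edge w, (m : ℝ) < x.height ∧ x.height ≤ m + 1 := fun x hx => by
    have h1 := lt_height_of_mem_edge hne hx
    have h2 := height_le_of_mem_edge hx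
    rw [hw] at h1 h2
    push_cast at h1 h2
    exact ⟨by linarith, h2⟩
  rw [weightedMeasure, setLIntegral_withDensity_eq_setLIntegral_mul _ hd hh (measurableSet_edge w)]
  constructor
  · rw [← lintegral_const_mul _ hh]
    refine setLIntegral_mono (hh.const_mul _) fun x hxe => ?_
    refine mul_le_mul' ?_ le_rfl
    rw [edgeWeight, ← ENNReal.ofReal_mul hc0]
    exact ENNReal.ofReal_le_ofReal (density_le_and_le hβ hC lam (hx x hxe).1 (hx x hxe).2).1
  · rw [← lintegral_const_mul _ hh, ← lintegral_const_mul _ (hd.mul hh)]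
    refine setLIntegral_mono ((hd.mul hh).const_mul _) fun x hxe => ?_
    rw [Pi.mul_apply, ← mul_assoc]
    refine mul_le_mul' ?_ le_rfl
    rw [edgeWeight, ← ENNReal.ofReal_mul hc0]
    exact ENNReal.ofReal_le_ofReal (density_le_and_le hβ hC lam (hx x hxe).1 (hx x hxe).2).2

/-- The Hardy inequality for the weights of the dyadic energy, which grow geometrically up to a power
as `θ > 0`. -/
theorem exists_tsum_besovWeight_mul_tail_le {ε p θ : ℝ} (hp : 1 ≤ p) (hε : 0 < ε) (hθ : 0 < θ)
    (lam : ℝ) :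
    ∃ c : ℝ≥0∞, c ≠ ∞ ∧ ∀ G : ℕ → ℝ≥0∞,
      ∑' m, besovWeight ε p θ lam m * (∑' j, G (m + j)) ^ p ≤
        c * ∑' m, besovWeight ε p θ lam m * G m ^ p := by
  have hp0 : 0 < p := by linarith
  have hδ : 0 < ε * θ := by positivity
  -- the norm of the `j`-th shift on the weighted `ℓ^p` space
  set c : ℕ → ℝ≥0∞ := fun j => ENNReal.ofReal (Real.exp (ε * θ) *
    (Real.exp (-(ε * θ * ((j : ℝ) + 1))) * ((j : ℝ) + 1) ^ (|lam| / p)))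
  have hcs : ∑' j, c j ≠ ∞ := ((summable_exp_mul_rpow hδ _).mul_left _).tsum_ofReal_ne_top
  refine ⟨(∑' j, c j) ^ p, ENNReal.rpow_ne_top_of_nonneg hp0.le hcs, fun G => ?_⟩
  refine tsum_mul_tail_rpow_le hp (fun j => (ENNReal.ofReal_pos.2 (by positivity)).ne') hcs
    (fun m j => ?_) G
  have hm : (0 : ℝ) ≤ m := Nat.cast_nonneg m
  have hj : (0 : ℝ) ≤ j := Nat.cast_nonneg j
  have hj1 : (0 : ℝ) < (j : ℝ) + 1 := by linarith
  have hm1 : (0 : ℝ) < (m : ℝ) + 1 := by linarith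
  have hmj : (0 : ℝ) < (m : ℝ) + j + 1 := by linarith
  rw [besovWeight, besovWeight, ENNReal.ofReal_rpow_of_nonneg (by positivity) hp0.le,
    ← ENNReal.ofReal_mul (by positivity)]
  refine ENNReal.ofReal_le_ofReal ?_
  have hr : ((m : ℝ) + 1) ^ lam ≤ ((j : ℝ) + 1) ^ |lam| * ((m : ℝ) + j + 1) ^ lam := by
    have := rpow_le_rpow_abs (κ := (j : ℝ) + 1) (r := ((m : ℝ) + 1) / ((m : ℝ) + j + 1))
      (by linarith)
      ((le_div_iff₀ hmj).2 ((inv_mul_le_iff₀ hj1).2 (by nlinarith)))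
      ((div_le_iff₀ hmj).2 (by nlinarith)) lam
    rwa [Real.div_rpow hm1.le hmj.le, div_le_iff₀ (Real.rpow_pos_of_pos hmj _)] at this
  rw [Real.mul_rpow (by positivity) (by positivity), Real.mul_rpow (by positivity) (by positivity),
    ← Real.rpow_mul hj1.le, div_mul_cancel₀ _ hp0.ne', ← Real.exp_mul, ← Real.exp_mul]
  push_cast
  calc Real.exp (ε * ((m : ℝ) + 1) * θ * p) * ((m : ℝ) + 1) ^ lam
      ≤ Real.exp (ε * ((m : ℝ) + 1) * θ * p) *
        (((j : ℝ) + 1) ^ |lam| * ((m : ℝ) + j + 1) ^ lam) := by gcongr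
    _ = (Real.exp (ε * θ * p) * Real.exp (-(ε * θ * ((j : ℝ) + 1)) * p) *
          Real.exp (ε * ((m : ℝ) + j + 1) * θ * p)) *
        (((j : ℝ) + 1) ^ |lam| * ((m : ℝ) + j + 1) ^ lam) := by
        rw [← Real.exp_add, ← Real.exp_add]
        congr 2
        ring
    _ = _ := by ring

/-! ### Functions with an upper gradient along rays -/

/-- The geodesic from the parent vertex to `x` lies in the half-open edge of `x` up to the parent
vertex itself, which is a null set. -/
theorem ofReal_abs_sub_vertex_dropLast_le {ε : ℝ} {u : Pt K → ℝ} {g : Pt K → ℝ≥0∞}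
    (hg : IsUpperGradient ε u g) (x : Pt K) :
    ENNReal.ofReal |u x - u (vertex x.word.dropLast)| ≤
      ∫⁻ z in edge x.word, g z ∂(arcLength K ε) := by
  rw [abs_sub_comm]
  refine (hg.2 _ _).trans ?_
  refine lintegral_mono' (Measure.restrict_mono_ae ?_) le_rfl
  have h0 : ∀ᵐ z ∂(arcLength K ε), z ≠ vertex x.word.dropLast := by
    rw [ae_iff]
    simpa using arcLength_null (ε := ε) (lengthMeasure_singleton (vertex x.word.dropLast))
  filter_upwards [h0] with z hz hzg
  exact ((geodesic_vertex_dropLast_subset x hzg).resolve_left hz).1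

theorem ofReal_abs_sub_vertex_word_le {ε : ℝ} {u : Pt K → ℝ} {g : Pt K → ℝ≥0∞}
    (hg : IsUpperGradient ε u g) (x : Pt K) :
    ENNReal.ofReal |u x - u (vertex x.word)| ≤ ∫⁻ z in edge x.word, g z ∂(arcLength K ε) :=
  (hg.2 _ _).trans (lintegral_mono_set (geodesic_vertex_word_subset x))

theorem setLIntegral_edge_arcLength_rpow_le {ε p : ℝ} (hε : 0 < ε) (hp : 1 ≤ p)
    {g : Pt K → ℝ≥0∞} (hg : Measurable g) {m : ℕ} {w : List (Fin K)} (hw : w.length = m + 1) :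
    (∫⁻ x in edge w, g x ∂(arcLength K ε)) ^ p ≤
      ENNReal.ofReal (Real.exp (-(ε * p * m))) * ∫⁻ x in edge w, g x ^ p ∂(lengthMeasure K) := by
  have hp0 : 0 < p := by linarith
  have hne : w ≠ [] := by rintro rfl; simp at hw
  have h1 : ∫⁻ x in edge w, g x ∂(arcLength K ε) ≤
      ENNReal.ofReal (Real.exp (-(ε * m))) * ∫⁻ x in edge w, g x ∂(lengthMeasure K) := by
    rw [arcLength, setLIntegral_withDensity_eq_setLIntegral_mul _ (measurable_density ε) hg
      (measurableSet_edge w), ← lintegral_const_mul _ hg]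
    refine setLIntegral_mono (hg.const_mul _) fun x hx => mul_le_mul' ?_ le_rfl
    refine ENNReal.ofReal_le_ofReal (Real.exp_le_exp.2 ?_)
    have := lt_height_of_mem_edge hne hx
    rw [hw] at this
    push_cast at this
    nlinarith
  calc (∫⁻ x in edge w, g x ∂(arcLength K ε)) ^ p
      ≤ (ENNReal.ofReal (Real.exp (-(ε * m))) * ∫⁻ x in edge w, g x ∂(lengthMeasure K)) ^ p :=
        ENNReal.rpow_le_rpow h1 hp0.le
    _ = ENNReal.ofReal (Real.exp (-(ε * p * m))) *
          (∫⁻ x in edge w, g x ∂(lengthMeasure K)) ^ p := by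
        rw [ENNReal.mul_rpow_of_nonneg _ _ hp0.le,
          ENNReal.ofReal_rpow_of_nonneg (Real.exp_pos _).le hp0.le, ← Real.exp_mul]
        congr 4
        ring
    _ ≤ _ := by
        refine mul_le_mul' le_rfl ?_
        refine (lintegral_rpow_le_measure_univ_mul hp hg.aemeasurable).trans (le_of_eq ?_)
        rw [Measure.restrict_apply_univ, lengthMeasure_edge hne, ENNReal.one_rpow, one_mul]

/-- The integral of `g` over the `(m + 1)`-st edge of the ray `ξ`. -/
noncomputable def rayIncrement (ε : ℝ) (g : Pt K → ℝ≥0∞) (ξ : Boundary K) (m : ℕ) : ℝ≥0∞ :=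
  ∫⁻ x in edge (vertexAt ξ (m + 1)), g x ∂(arcLength K ε)

theorem measurable_rayIncrement (ε : ℝ) (g : Pt K → ℝ≥0∞) (m : ℕ) :
    Measurable fun ξ => rayIncrement ε g ξ m :=
  (measurable_of_countable fun w : List (Fin K) => ∫⁻ x in edge w, g x ∂(arcLength K ε)).comp
    (measurable_vertexAt (m + 1))

/-- The trace of `u`: the limit of the values of `u` at the vertices of the ray `ξ`. It is meaningful
where this limit exists, which is almost everywhere for `u` in the Newtonian space; only its class
modulo `ν` enters the trace operator. -/
noncomputable def trace (u : Pt K → ℝ) (ξ : Boundary K) : ℝ :=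
  limUnder atTop fun n => u (vertex (vertexAt ξ n))

theorem edist_vertexAt_le {ε : ℝ} {u : Pt K → ℝ} {g : Pt K → ℝ≥0∞}
    (hg : IsUpperGradient ε u g) (ξ : Boundary K) (n : ℕ) :
    edist (u (vertex (vertexAt ξ n))) (u (vertex (vertexAt ξ (n + 1)))) ≤
      rayIncrement ε g ξ n := by
  rw [edist_comm, edist_dist, Real.dist_eq]
  simpa [rayIncrement, dropLast_vertexAt] using
    ofReal_abs_sub_vertex_dropLast_le hg (vertex (vertexAt ξ (n + 1)))

theorem tendsto_trace {ε : ℝ} {u : Pt K → ℝ} {g : Pt K → ℝ≥0∞} (hg : IsUpperGradient ε u g)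
    {ξ : Boundary K} (hξ : ∑' j, rayIncrement ε g ξ j ≠ ∞) :
    Tendsto (fun n => u (vertex (vertexAt ξ n))) atTop (𝓝 (trace u ξ)) :=
  (cauchySeq_of_edist_le_of_tsum_ne_top _ (edist_vertexAt_le hg ξ) hξ).tendsto_limUnder

theorem ofReal_abs_trace_sub_le {ε : ℝ} {u : Pt K → ℝ} {g : Pt K → ℝ≥0∞}
    (hg : IsUpperGradient ε u g) {ξ : Boundary K} (hξ : ∑' j, rayIncrement ε g ξ j ≠ ∞) (n : ℕ) :
    ENNReal.ofReal |trace u ξ - u (vertex (vertexAt ξ n))| ≤ ∑' j, rayIncrement ε g ξ (n + j) := by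
  rw [← Real.dist_eq, ← edist_dist, edist_comm]
  exact edist_le_tsum_of_edist_le_of_tendsto _ (edist_vertexAt_le hg ξ) (tendsto_trace hg hξ) n

theorem tendsto_rayFilter {ε : ℝ} {u : Pt K → ℝ} {g : Pt K → ℝ≥0∞} (hg : IsUpperGradient ε u g)
    {ξ : Boundary K} (hξ : ∑' j, rayIncrement ε g ξ j ≠ ∞) :
    Tendsto u (rayFilter ξ) (𝓝 (trace u ξ)) := by
  have hlen : Tendsto (fun x : Pt K => x.word.length) (rayFilter ξ) atTop := by
    have h1 : Tendsto (Pt.height : Pt K → ℝ) (rayFilter ξ) atTop :=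
      tendsto_comap.mono_left inf_le_left
    exact (tendsto_nat_ceil_atTop.comp h1).congr fun x => x.length_word.symm
  have hψ : Tendsto (fun n => (∫⁻ x in edge (vertexAt ξ n), g x ∂(arcLength K ε)) +
      edist (u (vertex (vertexAt ξ n))) (trace u ξ)) atTop (𝓝 0) := by
    have h1 : Tendsto (fun n => ∫⁻ x in edge (vertexAt ξ n), g x ∂(arcLength K ε)) atTop (𝓝 0) :=
      (tendsto_add_atTop_iff_nat 1).1 (ENNReal.tendsto_atTop_zero_of_tsum_ne_top hξ)
    simpa using h1.add (tendsto_iff_edist_tendsto_0.1 (tendsto_trace hg hξ))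
  refine tendsto_iff_edist_tendsto_0.2 ?_
  refine tendsto_of_tendsto_of_tendsto_of_le_of_le' tendsto_const_nhds (hψ.comp hlen)
    (Eventually.of_forall fun _ => zero_le) ?_
  have hmem : ∀ᶠ x in rayFilter ξ, ξ ∈ dyadic x.word :=
    mem_inf_of_right (mem_principal_self _)
  filter_upwards [hmem] with x hx
  have hx := mem_dyadic_iff.1 hx
  simp only [Function.comp_apply, hx]
  refine (edist_triangle _ (u (vertex x.word)) _).trans (add_le_add ?_ le_rfl)
  rw [edist_dist, Real.dist_eq]
  exact ofReal_abs_sub_vertex_word_le hg x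

/-! ### The trace operator -/

theorem eLpNorm_eq_lintegral_rpow {α : Type*} [MeasurableSpace α] {p : ℝ} (hp : 1 ≤ p)
    (μ : Measure α) (f : α → ℝ) :
    eLpNorm f (ENNReal.ofReal p) μ = (∫⁻ x, ENNReal.ofReal |f x| ^ p ∂μ) ^ (1 / p) := by
  have hp0 : 0 < p := by linarith
  rw [eLpNorm_eq_lintegral_rpow_enorm_toReal (by simpa using hp0) ENNReal.ofReal_ne_top,
    ENNReal.toReal_ofReal hp0.le]
  simp only [Real.enorm_eq_ofReal_abs]

/-- In the weights of the energy, the integrals of `g` over the edges of the rays are bounded by the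
norm of `g` in `L^p(μ_λ)`. -/
theorem exists_tsum_rayIncrement_le {β ε lam C p θ : ℝ} (hK : 2 ≤ K) (hβ : 0 < β) (hε : 0 < ε)
    (hC : 0 < C) (hp : 1 ≤ p) (hθ : ε * θ * p = ε * p - (β - Real.log K))
    {ν : Measure (Boundary K)} (hν : AhlforsRegular ε ν) :
    ∃ c : ℝ≥0∞, c ≠ ∞ ∧ ∀ g : Pt K → ℝ≥0∞, Measurable g →
      ∑' m, besovWeight ε p θ lam m * ∫⁻ ξ, rayIncrement ε g ξ m ^ p ∂ν ≤
        c * ∫⁻ x, g x ^ p ∂(weightedMeasure K β lam C) := by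
  obtain ⟨c₁, h₁⟩ := hν.exists_measure_dyadic hK hε
  obtain ⟨c₂, hc₂, h₂⟩ := exists_setLIntegral_edge_comparable K hβ hC lam
  refine ⟨c₁ * ENNReal.ofReal (Real.exp (ε * p)) * c₂, by finiteness, fun g hg => ?_⟩
  rw [lintegral_eq_tsum_edge (weightedMeasure_absolutelyContinuous β lam C),
    ← ENNReal.tsum_mul_left]
  refine ENNReal.tsum_le_tsum fun m => ?_
  simp only [rayIncrement]
  rw [← sum_measure_dyadic_mul ν (m + 1)
    fun w => (∫⁻ x in edge w, g x ∂(arcLength K ε)) ^ p, Finset.mul_sum, Finset.mul_sum]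
  refine Finset.sum_le_sum fun w _ => ?_
  set v := List.ofFn w
  have hv : v.length = m + 1 := List.length_ofFn
  have hexp : ENNReal.ofReal (Real.exp (ε * p * ((m : ℝ) + 1))) *
      ENNReal.ofReal (Real.exp (-(ε * p * m))) = ENNReal.ofReal (Real.exp (ε * p)) := by
    rw [← ENNReal.ofReal_mul (Real.exp_pos _).le, ← Real.exp_add]
    congr 2
    ring
  have hν1 : ν (dyadic v) * (K : ℝ≥0∞) ^ (m + 1) ≤ c₁ := hv ▸ (h₁ v).1
  rw [besovWeight_eq hK hθ]
  calc edgeWeight β lam m * ENNReal.ofReal (Real.exp (ε * p * ((m : ℝ) + 1))) *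
        (K : ℝ≥0∞) ^ (m + 1) * (ν (dyadic v) * (∫⁻ x in edge v, g x ∂(arcLength K ε)) ^ p)
      = edgeWeight β lam m * ENNReal.ofReal (Real.exp (ε * p * ((m : ℝ) + 1))) *
        (ν (dyadic v) * (K : ℝ≥0∞) ^ (m + 1)) *
        (∫⁻ x in edge v, g x ∂(arcLength K ε)) ^ p := by ring
    _ ≤ edgeWeight β lam m * ENNReal.ofReal (Real.exp (ε * p * ((m : ℝ) + 1))) * c₁ *
        (ENNReal.ofReal (Real.exp (-(ε * p * m))) *
          ∫⁻ x in edge v, g x ^ p ∂(lengthMeasure K)) :=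
        mul_le_mul' (mul_le_mul' le_rfl hν1) (setLIntegral_edge_arcLength_rpow_le hε hp hg hv)
    _ = c₁ * (ENNReal.ofReal (Real.exp (ε * p * ((m : ℝ) + 1))) *
        ENNReal.ofReal (Real.exp (-(ε * p * m)))) *
        (edgeWeight β lam m * ∫⁻ x in edge v, g x ^ p ∂(lengthMeasure K)) := by ring
    _ ≤ c₁ * ENNReal.ofReal (Real.exp (ε * p)) *
        (c₂ * ∫⁻ x in edge v, g x ^ p ∂(weightedMeasure K β lam C)) := by
        rw [hexp]
        exact mul_le_mul' le_rfl (h₂ m v hv _ (hg.pow_const p)).2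
    _ = _ := by ring

theorem measurable_tsum_rayIncrement (ε : ℝ) (g : Pt K → ℝ≥0∞) (m : ℕ) :
    Measurable fun ξ => ∑' j, rayIncrement ε g ξ (m + j) :=
  Measurable.tsum fun j => measurable_rayIncrement ε g (m + j)

theorem exists_tsum_ray_tail_le {β ε lam C p θ : ℝ} (hK : 2 ≤ K) (hβ : 0 < β) (hε : 0 < ε)
    (hC : 0 < C) (hp : 1 ≤ p) (hθ0 : 0 < θ) (hθ : ε * θ * p = ε * p - (β - Real.log K))
    {ν : Measure (Boundary K)} (hν : AhlforsRegular ε ν) :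
    ∃ c : ℝ≥0∞, c ≠ ∞ ∧ ∀ g : Pt K → ℝ≥0∞, Measurable g →
      ∑' m, besovWeight ε p θ lam m * ∫⁻ ξ, (∑' j, rayIncrement ε g ξ (m + j)) ^ p ∂ν ≤
        c * ∫⁻ x, g x ^ p ∂(weightedMeasure K β lam C) := by
  obtain ⟨c₁, hc₁, h₁⟩ := exists_tsum_rayIncrement_le (lam := lam) hK hβ hε hC hp hθ hν
  obtain ⟨c₂, hc₂, h₂⟩ := exists_tsum_besovWeight_mul_tail_le hp hε hθ0 lam
  refine ⟨c₂ * c₁, by finiteness, fun g hg => ?_⟩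
  have hm1 : ∀ m, Measurable fun ξ => (∑' j, rayIncrement ε g ξ (m + j)) ^ p :=
    fun m => (measurable_tsum_rayIncrement ε g m).pow_const p
  have hm2 : ∀ m, Measurable fun ξ => rayIncrement ε g ξ m ^ p :=
    fun m => (measurable_rayIncrement ε g m).pow_const p
  calc ∑' m, besovWeight ε p θ lam m * ∫⁻ ξ, (∑' j, rayIncrement ε g ξ (m + j)) ^ p ∂ν
      = ∫⁻ ξ, ∑' m, besovWeight ε p θ lam m * (∑' j, rayIncrement ε g ξ (m + j)) ^ p ∂ν := by
        rw [lintegral_tsum fun m => ((hm1 m).const_mul _).aemeasurable]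
        exact tsum_congr fun m => (lintegral_const_mul _ (hm1 m)).symm
    _ ≤ ∫⁻ ξ, c₂ * ∑' m, besovWeight ε p θ lam m * rayIncrement ε g ξ m ^ p ∂ν :=
        lintegral_mono fun ξ => h₂ _
    _ = c₂ * ∑' m, besovWeight ε p θ lam m * ∫⁻ ξ, rayIncrement ε g ξ m ^ p ∂ν := by
        rw [lintegral_const_mul _ (Measurable.tsum fun m => (hm2 m).const_mul _),
          lintegral_tsum fun m => ((hm2 m).const_mul _).aemeasurable]
        congr 1
        exact tsum_congr fun m => lintegral_const_mul _ (hm2 m)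
    _ ≤ c₂ * (c₁ * ∫⁻ x, g x ^ p ∂(weightedMeasure K β lam C)) := mul_le_mul' le_rfl (h₁ g hg)
    _ = _ := by ring

/-- If the upper gradient `g` is in `L^p(μ_λ)`, then almost every ray has finite `g`-length. -/
theorem ae_tsum_rayIncrement_ne_top {β ε lam C p θ : ℝ} (hK : 2 ≤ K) (hβ : 0 < β) (hε : 0 < ε)
    (hC : 0 < C) (hp : 1 ≤ p) (hθ0 : 0 < θ) (hθ : ε * θ * p = ε * p - (β - Real.log K))
    {ν : Measure (Boundary K)} (hν : AhlforsRegular ε ν) {g : Pt K → ℝ≥0∞} (hg : Measurable g)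
    (hgp : ∫⁻ x, g x ^ p ∂(weightedMeasure K β lam C) < ∞) :
    ∀ᵐ ξ ∂ν, ∑' j, rayIncrement ε g ξ j ≠ ∞ := by
  have hp0 : 0 < p := by linarith
  obtain ⟨c, hc, h⟩ := exists_tsum_ray_tail_le (lam := lam) hK hβ hε hC hp hθ0 hθ hν
  have h1 : besovWeight ε p θ lam 0 * ∫⁻ ξ, (∑' j, rayIncrement ε g ξ (0 + j)) ^ p ∂ν ≠ ∞ :=
    (((ENNReal.le_tsum 0).trans (h g hg)).trans_lt (ENNReal.mul_lt_top hc.lt_top hgp)).ne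
  have h2 : ∫⁻ ξ, (∑' j, rayIncrement ε g ξ (0 + j)) ^ p ∂ν ≠ ∞ := fun h2 => by
    rw [h2, ENNReal.mul_top (besovWeight_ne_zero _ _ _ _ _)] at h1
    exact h1 rfl
  filter_upwards [ae_lt_top ((measurable_tsum_rayIncrement ε g 0).pow_const p) h2] with ξ hξ
  simp only [zero_add] at hξ
  intro htop
  rw [htop, ENNReal.top_rpow_of_pos hp0] at hξ
  exact lt_irrefl _ hξ

/-- The value at the root is compared with the values on one edge at the root, and averaged. -/
theorem exists_root_rpow_le {β ε lam C p : ℝ} (hK : 2 ≤ K) (hβ : 0 < β) (hε : 0 < ε)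
    (hC : 0 < C) (hp : 1 ≤ p) :
    ∃ c : ℝ≥0∞, c ≠ ∞ ∧ ∀ (u : Pt K → ℝ) (g : Pt K → ℝ≥0∞), IsUpperGradient ε u g →
      ENNReal.ofReal |u (vertex [])| ^ p ≤
        c * (∫⁻ x, ENNReal.ofReal |u x| ^ p ∂(weightedMeasure K β lam C) +
          ∫⁻ x, g x ^ p ∂(weightedMeasure K β lam C)) := by
  have hp0 : 0 < p := by linarith
  obtain ⟨c₂, hc₂, h₂⟩ := exists_setLIntegral_edge_comparable K hβ hC lam
  set V := edgeWeight β lam 0 with hV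
  have hVt : V ≠ ∞ := edgeWeight_ne_top _ _ _
  have hV0 : V ≠ 0 := edgeWeight_ne_zero _ _ _
  set μ := weightedMeasure K β lam C
  have h2p : (2 : ℝ≥0∞) ^ (p - 1) ≠ ∞ :=
    ENNReal.rpow_ne_top_of_nonneg (by linarith) (by simp)
  refine ⟨V⁻¹ * (c₂ * 2 ^ (p - 1) * (1 + c₂ * c₂)), by finiteness, fun u g hg => ?_⟩
  have i : Fin K := ⟨0, by omega⟩
  set w : List (Fin K) := [i]
  have hw : w.length = 0 + 1 := rfl
  have hne : w ≠ [] := List.cons_ne_nil _ _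
  set a := ∫⁻ x in edge w, g x ∂(arcLength K ε)
  set A := ∫⁻ x, ENNReal.ofReal |u x| ^ p ∂μ
  set B := ∫⁻ x, g x ^ p ∂μ
  have hμw : μ (edge w) ≤ c₂ * V := by
    have := (h₂ 0 w hw (fun _ => 1) measurable_const).1
    simpa [lengthMeasure_edge hne] using this
  have hVw : ∀ t : ℝ≥0∞, V * t ≤ c₂ * ∫⁻ x in edge w, t ∂μ := fun t => by
    have := (h₂ 0 w hw (fun _ => t) measurable_const).2
    rwa [setLIntegral_const, lengthMeasure_edge hne, mul_one] at this
  have ha : V * a ^ p ≤ c₂ * B := by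
    have h1 := setLIntegral_edge_arcLength_rpow_le hε hp hg.1 hw
    simp only [Nat.cast_zero, mul_zero, neg_zero, Real.exp_zero, ENNReal.ofReal_one, one_mul] at h1
    calc V * a ^ p ≤ V * ∫⁻ x in edge w, g x ^ p ∂(lengthMeasure K) := mul_le_mul' le_rfl h1
      _ ≤ c₂ * ∫⁻ x in edge w, g x ^ p ∂μ := (h₂ 0 w hw _ (hg.1.pow_const p)).2
      _ ≤ c₂ * B := mul_le_mul' le_rfl (setLIntegral_le_lintegral _ _)
  have hpt : ∀ x ∈ edge w, ENNReal.ofReal |u (vertex [])| ^ p ≤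
      2 ^ (p - 1) * (ENNReal.ofReal |u x| ^ p + a ^ p) := by
    intro x hx
    have hx : x.word = w := hx
    have h1 := ofReal_abs_sub_rpow_le hp (u (vertex [])) 0 (u x)
    rw [sub_zero, zero_sub, abs_neg, add_comm, abs_sub_comm] at h1
    refine h1.trans (mul_le_mul' le_rfl (add_le_add le_rfl (ENNReal.rpow_le_rpow ?_ hp0.le)))
    have := ofReal_abs_sub_vertex_dropLast_le hg x
    rw [hx] at this
    exact this
  have key : V * ENNReal.ofReal |u (vertex [])| ^ p ≤
      c₂ * 2 ^ (p - 1) * (1 + c₂ * c₂) * (A + B) := by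
    calc V * ENNReal.ofReal |u (vertex [])| ^ p
        ≤ c₂ * ∫⁻ x in edge w, ENNReal.ofReal |u (vertex [])| ^ p ∂μ := hVw _
      _ ≤ c₂ * ∫⁻ x in edge w, 2 ^ (p - 1) * (ENNReal.ofReal |u x| ^ p + a ^ p) ∂μ :=
          mul_le_mul' le_rfl (setLIntegral_mono' (measurableSet_edge w) hpt)
      _ = c₂ * (2 ^ (p - 1) *
            (∫⁻ x in edge w, ENNReal.ofReal |u x| ^ p ∂μ + a ^ p * μ (edge w))) := by
          rw [lintegral_const_mul' _ _ h2p, lintegral_add_right _ measurable_const,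
            setLIntegral_const]
      _ ≤ c₂ * (2 ^ (p - 1) * (A + c₂ * (c₂ * B))) := by
          refine mul_le_mul' le_rfl (mul_le_mul' le_rfl (add_le_add
            (setLIntegral_le_lintegral _ _) ?_))
          calc a ^ p * μ (edge w) ≤ a ^ p * (c₂ * V) := mul_le_mul' le_rfl hμw
            _ = c₂ * (V * a ^ p) := by ring
            _ ≤ _ := mul_le_mul' le_rfl ha
      _ ≤ c₂ * (2 ^ (p - 1) * (A + c₂ * (c₂ * B) + (B + c₂ * (c₂ * A)))) :=
          mul_le_mul' le_rfl (mul_le_mul' le_rfl le_self_add)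
      _ = _ := by ring
  calc ENNReal.ofReal |u (vertex [])| ^ p
      = V⁻¹ * (V * ENNReal.ofReal |u (vertex [])| ^ p) := by
        rw [← mul_assoc, ENNReal.inv_mul_cancel hV0 hVt, one_mul]
    _ ≤ V⁻¹ * (c₂ * 2 ^ (p - 1) * (1 + c₂ * c₂) * (A + B)) := mul_le_mul' le_rfl key
    _ = _ := by ring

theorem aestronglyMeasurable_trace {ε : ℝ} {ν : Measure (Boundary K)} {u : Pt K → ℝ}
    {g : Pt K → ℝ≥0∞} (hg : IsUpperGradient ε u g)
    (hξ : ∀ᵐ ξ ∂ν, ∑' j, rayIncrement ε g ξ j ≠ ∞) : AEStronglyMeasurable (trace u) ν := by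
  refine aestronglyMeasurable_of_tendsto_ae atTop
    (f := fun n ξ => u (vertex (vertexAt ξ n))) (fun n => ?_) ?_
  · exact ((measurable_of_countable fun w : List (Fin K) => u (vertex w)).comp
      (measurable_vertexAt n)).aestronglyMeasurable
  · filter_upwards [hξ] with ξ hξ using tendsto_trace hg hξ

/-- The difference of the mean values of `Tu` over a dyadic set and its parent is controlled by the
tail of the ray integrals, by comparison of both with the value of `u` at the parent. -/
theorem dyadicEnergy_trace_le {ε p θ lam : ℝ} (hp : 1 ≤ p) {ν : Measure (Boundary K)}
    [IsFiniteMeasure ν] (hν : ∀ w, ν (dyadic w) ≠ 0) {u : Pt K → ℝ} {g : Pt K → ℝ≥0∞}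
    (hg : IsUpperGradient ε u g) (hξ : ∀ᵐ ξ ∂ν, ∑' j, rayIncrement ε g ξ j ≠ ∞)
    (hint : Integrable (trace u) ν) :
    dyadicEnergy ε p θ lam ν (trace u) ≤ 2 ^ (p - 1) * 2 *
      ∑' m, besovWeight ε p θ lam m * ∫⁻ ξ, (∑' j, rayIncrement ε g ξ (m + j)) ^ p ∂ν := by
  have hp0 : 0 < p := by linarith
  have h2p : (2 : ℝ≥0∞) ^ (p - 1) ≠ ∞ :=
    ENNReal.rpow_ne_top_of_nonneg (by linarith) (by simp)
  rw [dyadicEnergy_eq_tsum_lintegral, ← ENNReal.tsum_mul_left]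
  refine ENNReal.tsum_le_tsum fun m => ?_
  rw [mul_left_comm]
  refine mul_le_mul' le_rfl ?_
  have hH : ∫⁻ ξ, ENNReal.ofReal |trace u ξ - u (vertex (vertexAt ξ m))| ^ p ∂ν ≤
      ∫⁻ ξ, (∑' j, rayIncrement ε g ξ (m + j)) ^ p ∂ν := by
    refine lintegral_mono_ae ?_
    filter_upwards [hξ] with ξ hξ
    exact ENNReal.rpow_le_rpow (ofReal_abs_trace_sub_le hg hξ m) hp0.le
  have h1 := lintegral_mean_sub_rpow_le hp hint hν m fun w => u (vertex w)
  have h2 := lintegral_mean_sub_rpow_le hp hint hν (m + 1) fun w => u (vertex w.dropLast)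
  simp only [dropLast_vertexAt] at h2
  have hmeas : Measurable fun ξ : Boundary K => ENNReal.ofReal
      |mean ν (trace u) (vertexAt ξ m) - u (vertex (vertexAt ξ m))| ^ p :=
    (measurable_of_countable fun w : List (Fin K) =>
      ENNReal.ofReal |mean ν (trace u) w - u (vertex w)| ^ p).comp (measurable_vertexAt m)
  calc ∫⁻ ξ, ENNReal.ofReal |mean ν (trace u) (vertexAt ξ (m + 1)) -
        mean ν (trace u) (vertexAt ξ m)| ^ p ∂ν
      ≤ ∫⁻ ξ, 2 ^ (p - 1) * (ENNReal.ofReal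
          |mean ν (trace u) (vertexAt ξ (m + 1)) - u (vertex (vertexAt ξ m))| ^ p +
        ENNReal.ofReal |mean ν (trace u) (vertexAt ξ m) - u (vertex (vertexAt ξ m))| ^ p) ∂ν :=
        lintegral_mono fun ξ => ofReal_abs_sub_rpow_le hp _ _ _
    _ ≤ 2 ^ (p - 1) * (∫⁻ ξ, (∑' j, rayIncrement ε g ξ (m + j)) ^ p ∂ν +
        ∫⁻ ξ, (∑' j, rayIncrement ε g ξ (m + j)) ^ p ∂ν) := by
        rw [lintegral_const_mul' _ _ h2p, lintegral_add_right _ hmeas]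
        exact mul_le_mul' le_rfl (add_le_add (h2.trans hH) (h1.trans hH))
    _ = _ := by ring

/-- The trace estimate, for a single upper gradient. -/
theorem exists_trace_le {β ε lam C p θ : ℝ} (hK : 2 ≤ K) (hβ : 0 < β) (hε : 0 < ε)
    (hC : 0 < C) (hp : 1 ≤ p) (hθ0 : 0 < θ) (hθ : ε * θ * p = ε * p - (β - Real.log K))
    {ν : Measure (Boundary K)} (hν : AhlforsRegular ε ν) :
    ∃ c : ℝ≥0∞, c ≠ ∞ ∧ ∀ (u : Pt K → ℝ) (g : Pt K → ℝ≥0∞), IsUpperGradient ε u g →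
      ∫⁻ x, ENNReal.ofReal |u x| ^ p ∂(weightedMeasure K β lam C) < ∞ →
      ∫⁻ x, g x ^ p ∂(weightedMeasure K β lam C) < ∞ →
      MemLp (trace u) (ENNReal.ofReal p) ν ∧
      ∫⁻ ξ, ENNReal.ofReal |trace u ξ| ^ p ∂ν + dyadicEnergy ε p θ lam ν (trace u) ≤
        c * (∫⁻ x, ENNReal.ofReal |u x| ^ p ∂(weightedMeasure K β lam C) +
          ∫⁻ x, g x ^ p ∂(weightedMeasure K β lam C)) := by
  have hp0 : 0 < p := by linarith
  have hfin := hν.isFiniteMeasure hε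
  have h2p : (2 : ℝ≥0∞) ^ (p - 1) ≠ ∞ :=
    ENNReal.rpow_ne_top_of_nonneg (by linarith) (by simp)
  obtain ⟨c₁, hc₁, h₁⟩ := exists_tsum_ray_tail_le (lam := lam) hK hβ hε hC hp hθ0 hθ hν
  obtain ⟨c₂, hc₂, h₂⟩ := exists_root_rpow_le (lam := lam) hK hβ hε hC hp
  have hνne : ∀ w : List (Fin K), ν (dyadic w) ≠ 0 := by
    obtain ⟨c, hc⟩ := hν.exists_measure_dyadic hK hε
    intro w hw
    have := (hc w).2
    rw [hw, mul_zero] at this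
    exact absurd this (by simp)
  set W := besovWeight ε p θ lam 0
  have hWt : W ≠ ∞ := besovWeight_ne_top _ _ _ _ _
  have hW0 : W ≠ 0 := besovWeight_ne_zero _ _ _ _ _
  set μ := weightedMeasure K β lam C
  refine ⟨2 ^ (p - 1) * (c₂ * ν Set.univ + W⁻¹ * c₁) + 2 ^ (p - 1) * 2 * c₁, by finiteness,
    fun u g hg hA hB => ?_⟩
  set A := ∫⁻ x, ENNReal.ofReal |u x| ^ p ∂μ
  set B := ∫⁻ x, g x ^ p ∂μ
  have hξ := ae_tsum_rayIncrement_ne_top hK hβ hε hC hp hθ0 hθ hν hg.1 hB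
  have hmeas := aestronglyMeasurable_trace hg hξ
  have hT := h₁ g hg.1
  have hH0 : ∫⁻ ξ, (∑' j, rayIncrement ε g ξ (0 + j)) ^ p ∂ν ≤ W⁻¹ * (c₁ * B) := by
    calc _ = W⁻¹ * (W * ∫⁻ ξ, (∑' j, rayIncrement ε g ξ (0 + j)) ^ p ∂ν) := by
          rw [← mul_assoc, ENNReal.inv_mul_cancel hW0 hWt, one_mul]
      _ ≤ _ := mul_le_mul' le_rfl ((ENNReal.le_tsum 0).trans hT)
  have hL : ∫⁻ ξ, ENNReal.ofReal |trace u ξ| ^ p ∂ν ≤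
      2 ^ (p - 1) * (c₂ * ν Set.univ + W⁻¹ * c₁) * (A + B) := by
    calc ∫⁻ ξ, ENNReal.ofReal |trace u ξ| ^ p ∂ν
        ≤ ∫⁻ ξ, 2 ^ (p - 1) * ((∑' j, rayIncrement ε g ξ (0 + j)) ^ p +
            ENNReal.ofReal |u (vertex [])| ^ p) ∂ν := by
          refine lintegral_mono_ae ?_
          filter_upwards [hξ] with ξ hξ
          have h := ofReal_abs_sub_rpow_le hp (trace u ξ) 0 (u (vertex []))
          rw [sub_zero, zero_sub, abs_neg] at h
          refine h.trans (mul_le_mul' le_rfl (add_le_add (ENNReal.rpow_le_rpow ?_ hp0.le) le_rfl))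
          simpa using ofReal_abs_trace_sub_le hg hξ 0
      _ = 2 ^ (p - 1) * (∫⁻ ξ, (∑' j, rayIncrement ε g ξ (0 + j)) ^ p ∂ν +
            ENNReal.ofReal |u (vertex [])| ^ p * ν Set.univ) := by
          rw [lintegral_const_mul' _ _ h2p, lintegral_add_right _ measurable_const, lintegral_const]
      _ ≤ 2 ^ (p - 1) * (W⁻¹ * (c₁ * (A + B)) + c₂ * (A + B) * ν Set.univ) := by
          refine mul_le_mul' le_rfl (add_le_add (hH0.trans ?_) (mul_le_mul' (h₂ u g hg) le_rfl))
          exact mul_le_mul' le_rfl (mul_le_mul' le_rfl le_add_self)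
      _ = _ := by ring
  have hmem : MemLp (trace u) (ENNReal.ofReal p) ν := by
    refine ⟨hmeas, ?_⟩
    rw [eLpNorm_eq_lintegral_rpow hp]
    refine ENNReal.rpow_lt_top_of_nonneg (by positivity) (hL.trans_lt ?_).ne
    have := ENNReal.add_lt_top.2 ⟨hA, hB⟩
    finiteness
  refine ⟨hmem, ?_⟩
  rw [add_mul]
  refine add_le_add hL ?_
  refine (dyadicEnergy_trace_le hp hνne hg hξ (hmem.integrable (by simpa using hp))).trans ?_
  rw [mul_assoc (2 ^ (p - 1) * 2)]
  refine mul_le_mul' le_rfl (hT.trans ?_)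
  exact mul_le_mul' le_rfl le_add_self

/-! ### The extension operator -/

/-- The length in `d_X` of an edge whose lower end has height `n`. -/
noncomputable def edgeLength (ε : ℝ) (n : ℕ) : ℝ :=
  (Real.exp (-ε * ((n : ℝ) - 1)) - Real.exp (-ε * n)) / ε

theorem edgeLength_pos {ε : ℝ} (hε : 0 < ε) (n : ℕ) : 0 < edgeLength ε n := by
  refine div_pos (sub_pos.2 (Real.exp_lt_exp.2 ?_)) hε
  nlinarith

theorem exp_le_edgeLength {ε : ℝ} (hε : 0 < ε) (n : ℕ) : Real.exp (-(ε * n)) ≤ edgeLength ε n := by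
  rw [edgeLength, le_div_iff₀ hε]
  have h : Real.exp (-ε * ((n : ℝ) - 1)) = Real.exp (-(ε * n)) * Real.exp ε := by
    rw [← Real.exp_add]; congr 1; ring
  rw [h, neg_mul]
  nlinarith [Real.add_one_le_exp ε, Real.exp_pos (-(ε * n))]

/-- The jump of the mean values along the edge that ends at `w`. -/
noncomputable def meanJump (ν : Measure (Boundary K)) (f : Boundary K → ℝ) (w : List (Fin K)) : ℝ :=
  mean ν f w - mean ν f w.dropLast

/-- The formula holds at the root as well, where the jump is zero. -/
theorem extension_eq {ε : ℝ} (hε : 0 < ε) (ν : Measure (Boundary K)) (f : Boundary K → ℝ)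
    (x : Pt K) :
    extension ε ν f x = mean ν f x.word.dropLast +
      meanJump ν f x.word / edgeLength ε x.word.length *
        ((Real.exp (-ε * ((x.word.length : ℝ) - 1)) - Real.exp (-ε * x.height)) / ε) := by
  by_cases hw : x.word = []
  · simp [extension, meanJump, hw]
  · rw [extension, treeDist_vertex_dropLast hε hw]
    have h := treeDist_vertex_dropLast hε (x := vertex x.word) hw
    rw [word_vertex] at h
    rw [h]
    rfl

theorem extension_vertex {ε : ℝ} (hε : 0 < ε) (ν : Measure (Boundary K)) (f : Boundary K → ℝ)
    (w : List (Fin K)) : extension ε ν f (vertex w) = mean ν f w := by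
  rw [extension_eq hε]
  change mean ν f w.dropLast + meanJump ν f w / edgeLength ε w.length * edgeLength ε w.length = _
  rw [div_mul_cancel₀ _ (edgeLength_pos hε _).ne', meanJump]
  ring

theorem measurable_extension {ε : ℝ} (hε : 0 < ε) (ν : Measure (Boundary K)) (f : Boundary K → ℝ) :
    Measurable (extension ε ν f) := by
  have hw : ∀ φ : List (Fin K) → ℝ, Measurable fun x : Pt K => φ x.word :=
    fun φ => (measurable_of_countable φ).comp measurable_word
  have hfun : extension ε ν f = _ := funext fun x => extension_eq hε ν f x
  rw [hfun]
  refine (hw fun w => mean ν f w.dropLast).add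
    ((hw fun w => meanJump ν f w / edgeLength ε w.length).mul
      (((hw fun w => Real.exp (-ε * ((w.length : ℝ) - 1))).sub ?_).div_const ε))
  exact Real.measurable_exp.comp (measurable_height.const_mul _)

/-- The derivative of the extension with respect to arc length. -/
noncomputable def extensionGradient (ε : ℝ) (ν : Measure (Boundary K)) (f : Boundary K → ℝ)
    (x : Pt K) : ℝ≥0∞ :=
  ENNReal.ofReal (|meanJump ν f x.word| / edgeLength ε x.word.length)

theorem measurable_extensionGradient (ε : ℝ) (ν : Measure (Boundary K)) (f : Boundary K → ℝ) :
    Measurable (extensionGradient ε ν f) :=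
  (measurable_of_countable fun w : List (Fin K) =>
    ENNReal.ofReal (|meanJump ν f w| / edgeLength ε w.length)).comp measurable_word

theorem isUpperGradient_extension {ε : ℝ} (hε : 0 < ε) (ν : Measure (Boundary K))
    (f : Boundary K → ℝ) :
    IsUpperGradient ε (extension ε ν f) (extensionGradient ε ν f) := by
  refine isUpperGradient_of_edge (measurable_extensionGradient ε ν f) fun x y hxy hcase => ?_
  by_cases hy : y.word = []
  · have hxw : x.word = [] := List.prefix_nil.1 (hy ▸ hxy.2)
    have : ∀ z : Pt K, z.word = [] → extension ε ν f z = mean ν f [] := fun z hz => by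
      rw [extension_eq hε]; simp [hz, meanJump]
    simp [this x hxw, this y hy]
  set w := y.word with hw
  set J := meanJump ν f w / edgeLength ε w.length with hJ
  have hd := edgeLength_pos hε w.length
  have hx : (w.length : ℝ) - 1 ≤ x.height ∧ extension ε ν f x = mean ν f w.dropLast +
      J * ((Real.exp (-ε * ((w.length : ℝ) - 1)) - Real.exp (-ε * x.height)) / ε) := by
    rcases hcase with h | rfl
    · refine ⟨(lt_height_of_mem_edge hy h).le, ?_⟩
      rw [extension_eq hε, h]
    · rw [height_vertex, cast_length_dropLast hy]
      refine ⟨le_rfl, ?_⟩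
      rw [extension_vertex hε]
      ring
  have hdiff : |extension ε ν f y - extension ε ν f x| = |meanJump ν f w| / edgeLength ε w.length *
      ((Real.exp (-ε * x.height) - Real.exp (-ε * y.height)) / ε) := by
    have hnn : 0 ≤ (Real.exp (-ε * x.height) - Real.exp (-ε * y.height)) / ε := by
      refine div_nonneg (sub_nonneg.2 (Real.exp_le_exp.2 ?_)) hε.le
      nlinarith [hxy.1]
    have habs : |meanJump ν f w| / edgeLength ε w.length = |J| := by
      rw [hJ, abs_div, abs_of_pos hd]
    have hsub : extension ε ν f y - extension ε ν f x =
        J * ((Real.exp (-ε * x.height) - Real.exp (-ε * y.height)) / ε) := by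
      rw [extension_eq hε ν f y, hx.2, ← hw, ← hJ]
      ring
    rw [hsub, habs, abs_mul, abs_of_nonneg hnn]
  calc ENNReal.ofReal |extension ε ν f y - extension ε ν f x|
      = ∫⁻ _ in edge w ∩ Pt.height ⁻¹' Set.Ioc x.height y.height,
          ENNReal.ofReal (|meanJump ν f w| / edgeLength ε w.length) ∂(arcLength K ε) := by
        rw [setLIntegral_const, arcLength_edge_inter_Ioc hε hy hx.1 hxy.1 y.height_le, hdiff,
          ENNReal.ofReal_mul (by positivity)]
    _ = ∫⁻ z in edge w ∩ Pt.height ⁻¹' Set.Ioc x.height y.height,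
          extensionGradient ε ν f z ∂(arcLength K ε) := by
        refine setLIntegral_congr_fun
          ((measurableSet_edge w).inter (measurable_height measurableSet_Ioc)) fun z hz => ?_
        have hz : z.word = w := hz.1
        simp only [extensionGradient, hz]
    _ ≤ _ := lintegral_mono_set (edge_inter_subset_segment hxy)

theorem exists_lintegral_extensionGradient_le {β ε lam C p θ : ℝ} (hK : 2 ≤ K) (hβ : 0 < β)
    (hε : 0 < ε) (hC : 0 < C) (hp : 1 ≤ p) (hθ : ε * θ * p = ε * p - (β - Real.log K))
    {ν : Measure (Boundary K)} (hν : AhlforsRegular ε ν) :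
    ∃ c : ℝ≥0∞, c ≠ ∞ ∧ ∀ f : Boundary K → ℝ,
      ∫⁻ x, extensionGradient ε ν f x ^ p ∂(weightedMeasure K β lam C) ≤
        c * dyadicEnergy ε p θ lam ν f := by
  have hp0 : 0 < p := by linarith
  obtain ⟨c₁, h₁⟩ := hν.exists_measure_dyadic hK hε
  obtain ⟨c₂, hc₂, h₂⟩ := exists_setLIntegral_edge_comparable K hβ hC lam
  refine ⟨c₂ * c₁, by finiteness, fun f => ?_⟩
  rw [lintegral_eq_tsum_edge (weightedMeasure_absolutelyContinuous β lam C), dyadicEnergy,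
    ← ENNReal.tsum_mul_left]
  refine ENNReal.tsum_le_tsum fun m => ?_
  rw [Finset.mul_sum, Finset.mul_sum]
  refine Finset.sum_le_sum fun w _ => ?_
  set v := List.ofFn w
  have hv : v.length = m + 1 := List.length_ofFn
  have hne : v ≠ [] := by intro h; simp [h] at hv
  have hgrad : ∀ x ∈ edge v, extensionGradient ε ν f x ^ p ≤
      ENNReal.ofReal (Real.exp (ε * p * ((m : ℝ) + 1))) *
        ENNReal.ofReal |meanJump ν f v| ^ p := by
    intro x hx
    have hx : x.word = v := hx
    rw [extensionGradient, hx, hv]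
    have h := exp_le_edgeLength hε (m + 1)
    have h1 : |meanJump ν f v| / edgeLength ε (m + 1) ≤
        Real.exp (ε * ((m : ℝ) + 1)) * |meanJump ν f v| := by
      rw [div_le_iff₀ (edgeLength_pos hε _)]
      calc |meanJump ν f v| = Real.exp (ε * ((m : ℝ) + 1)) * |meanJump ν f v| *
            Real.exp (-(ε * ((m + 1 : ℕ) : ℝ))) := by
            rw [mul_right_comm, ← Real.exp_add]; push_cast; simp
        _ ≤ _ := by gcongr
    refine (ENNReal.rpow_le_rpow (ENNReal.ofReal_le_ofReal h1) hp0.le).trans (le_of_eq ?_)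
    rw [ENNReal.ofReal_mul (Real.exp_pos _).le, ENNReal.mul_rpow_of_nonneg _ _ hp0.le,
      ENNReal.ofReal_rpow_of_nonneg (Real.exp_pos _).le hp0.le, ← Real.exp_mul]
    rw [show ε * ((m : ℝ) + 1) * p = ε * p * ((m : ℝ) + 1) by ring]
  have hν1 : 1 ≤ c₁ * (K : ℝ≥0∞) ^ (m + 1) * ν (dyadic v) := hv ▸ (h₁ v).2
  have hW := besovWeight_eq (lam := lam) hK hθ m
  rw [besovWeight] at hW
  rw [hW]
  change _ ≤ c₂ * c₁ * (_ * (ν (dyadic v) * ENNReal.ofReal |meanJump ν f v| ^ p))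
  set D := ENNReal.ofReal (Real.exp (ε * p * ((m : ℝ) + 1)))
  set a := ENNReal.ofReal |meanJump ν f v| ^ p
  calc ∫⁻ x in edge v, extensionGradient ε ν f x ^ p ∂(weightedMeasure K β lam C)
      ≤ c₂ * edgeWeight β lam m *
          ∫⁻ x in edge v, extensionGradient ε ν f x ^ p ∂(lengthMeasure K) :=
        (h₂ m v hv _ ((measurable_extensionGradient ε ν f).pow_const p)).1
    _ ≤ c₂ * edgeWeight β lam m * ∫⁻ _ in edge v, D * a ∂(lengthMeasure K) :=
        mul_le_mul' le_rfl (setLIntegral_mono measurable_const hgrad)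
    _ = c₂ * edgeWeight β lam m * (D * a) * 1 := by
        rw [setLIntegral_const, lengthMeasure_edge hne, mul_one, mul_one]
    _ ≤ c₂ * edgeWeight β lam m * (D * a) * (c₁ * (K : ℝ≥0∞) ^ (m + 1) * ν (dyadic v)) :=
        mul_le_mul' le_rfl hν1
    _ = _ := by ring

/-- On an edge, the extension is a convex combination of the two mean values. -/
theorem abs_extension_le {ε : ℝ} (hε : 0 < ε) (ν : Measure (Boundary K)) (f : Boundary K → ℝ)
    {x : Pt K} (hx : x.word ≠ []) :
    |extension ε ν f x| ≤ |mean ν f x.word| + |mean ν f x.word.dropLast| := by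
  set d := edgeLength ε x.word.length
  have hdpos : 0 < d := edgeLength_pos hε _
  set e := (Real.exp (-ε * ((x.word.length : ℝ) - 1)) - Real.exp (-ε * x.height)) / ε
  have he0 : 0 ≤ e := by
    refine div_nonneg (sub_nonneg.2 (Real.exp_le_exp.2 ?_)) hε.le
    nlinarith [lt_height_of_mem_edge (x := x) hx rfl]
  have hed : e ≤ d := by
    exact div_le_div_of_nonneg_right
      (sub_le_sub_left (Real.exp_le_exp.2 (by nlinarith [x.height_le])) _) hε.le
  set t := e / d with ht
  have ht0 : 0 ≤ t := div_nonneg he0 hdpos.le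
  have ht1 : t ≤ 1 := (div_le_one hdpos).2 hed
  have heq : extension ε ν f x = (1 - t) * mean ν f x.word.dropLast + t * mean ν f x.word := by
    rw [extension_eq hε, meanJump, ht]
    ring
  rw [heq]
  refine (abs_add_le _ _).trans ?_
  rw [abs_mul, abs_mul, abs_of_nonneg ht0, abs_of_nonneg (sub_nonneg.2 ht1)]
  nlinarith [abs_nonneg (mean ν f x.word), abs_nonneg (mean ν f x.word.dropLast)]

theorem exists_lintegral_extension_le {β ε lam C p : ℝ} (hK : 2 ≤ K) (hβK : Real.log K < β)
    (hβ : 0 < β) (hε : 0 < ε) (hC : 0 < C) (hp : 1 ≤ p)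
    {ν : Measure (Boundary K)} (hν : AhlforsRegular ε ν) :
    ∃ c : ℝ≥0∞, c ≠ ∞ ∧ ∀ f : Boundary K → ℝ, Integrable f ν →
      ∫⁻ x, ENNReal.ofReal |extension ε ν f x| ^ p ∂(weightedMeasure K β lam C) ≤
        c * ∫⁻ ξ, ENNReal.ofReal |f ξ| ^ p ∂ν := by
  have hp0 : 0 < p := by linarith
  have hfin := hν.isFiniteMeasure hε
  have h2p : (2 : ℝ≥0∞) ^ (p - 1) ≠ ∞ :=
    ENNReal.rpow_ne_top_of_nonneg (by linarith) (by simp)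
  obtain ⟨c₁, h₁⟩ := hν.exists_measure_dyadic hK hε
  obtain ⟨c₂, hc₂, h₂⟩ := exists_setLIntegral_edge_comparable K hβ hC lam
  have hS := tsum_edgeWeight_mul_ne_top hK hβK lam
  have hνne : ∀ w : List (Fin K), ν (dyadic w) ≠ 0 := by
    intro w hw
    have := (h₁ w).2
    rw [hw, mul_zero] at this
    exact absurd this (by simp)
  refine ⟨(∑' m, edgeWeight β lam m * (K : ℝ≥0∞) ^ (m + 1)) * (c₂ * c₁ * 2 ^ (p - 1) * 2),
    by finiteness, fun f hf => ?_⟩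
  set N := ∫⁻ ξ, ENNReal.ofReal |f ξ| ^ p ∂ν
  have hmean : ∀ n, ∫⁻ ξ, ENNReal.ofReal |mean ν f (vertexAt ξ n)| ^ p ∂ν ≤ N := fun n => by
    simpa using lintegral_mean_sub_rpow_le hp hf hνne n fun _ => 0
  rw [lintegral_eq_tsum_edge (weightedMeasure_absolutelyContinuous β lam C), mul_assoc,
    ← ENNReal.tsum_mul_right]
  refine ENNReal.tsum_le_tsum fun m => ?_
  set φ : List (Fin K) → ℝ≥0∞ := fun w => 2 ^ (p - 1) *
    (ENNReal.ofReal |mean ν f w| ^ p + ENNReal.ofReal |mean ν f w.dropLast| ^ p)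
  have hedge : ∀ w : Fin (m + 1) → Fin K,
      ∫⁻ x in edge (List.ofFn w), ENNReal.ofReal |extension ε ν f x| ^ p
        ∂(weightedMeasure K β lam C) ≤ c₂ * edgeWeight β lam m * (c₁ * (K : ℝ≥0∞) ^ (m + 1)) *
          (ν (dyadic (List.ofFn w)) * φ (List.ofFn w)) := by
    intro w
    set v := List.ofFn w
    have hv : v.length = m + 1 := List.length_ofFn
    have hne : v ≠ [] := by intro h; simp [h] at hv
    have hν1 : 1 ≤ c₁ * (K : ℝ≥0∞) ^ (m + 1) * ν (dyadic v) := hv ▸ (h₁ v).2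
    have hpt : ∀ x ∈ edge v, ENNReal.ofReal |extension ε ν f x| ^ p ≤ φ v := by
      intro x hx
      have hx : x.word = v := hx
      have h := abs_extension_le hε ν f (x := x) (hx ▸ hne)
      rw [hx] at h
      refine le_trans (ENNReal.rpow_le_rpow ?_ hp0.le)
        (ENNReal.rpow_add_le_mul_rpow_add_rpow _ _ hp)
      rw [← ENNReal.ofReal_add (abs_nonneg _) (abs_nonneg _)]
      exact ENNReal.ofReal_le_ofReal h
    calc _ ≤ c₂ * edgeWeight β lam m *
          ∫⁻ x in edge v, ENNReal.ofReal |extension ε ν f x| ^ p ∂(lengthMeasure K) :=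
          (h₂ m v hv _ ((measurable_extension hε ν f).norm.ennreal_ofReal.pow_const p)).1
      _ ≤ c₂ * edgeWeight β lam m * ∫⁻ _ in edge v, φ v ∂(lengthMeasure K) :=
          mul_le_mul' le_rfl (setLIntegral_mono measurable_const hpt)
      _ = c₂ * edgeWeight β lam m * φ v * 1 := by
          rw [setLIntegral_const, lengthMeasure_edge hne, mul_one, mul_one]
      _ ≤ c₂ * edgeWeight β lam m * φ v * (c₁ * (K : ℝ≥0∞) ^ (m + 1) * ν (dyadic v)) :=
          mul_le_mul' le_rfl hν1
      _ = _ := by ring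
  have hmeas : Measurable fun ξ : Boundary K => ENNReal.ofReal |mean ν f (vertexAt ξ m)| ^ p :=
    (measurable_of_countable fun w : List (Fin K) => ENNReal.ofReal |mean ν f w| ^ p).comp
      (measurable_vertexAt m)
  have hφ : ∫⁻ ξ, φ (vertexAt ξ (m + 1)) ∂ν ≤ 2 ^ (p - 1) * (N + N) := by
    simp only [φ, dropLast_vertexAt]
    rw [lintegral_const_mul' _ _ h2p, lintegral_add_right _ hmeas]
    exact mul_le_mul' le_rfl (add_le_add (hmean _) (hmean _))
  calc _ ≤ ∑ w : Fin (m + 1) → Fin K, c₂ * edgeWeight β lam m * (c₁ * (K : ℝ≥0∞) ^ (m + 1)) *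
          (ν (dyadic (List.ofFn w)) * φ (List.ofFn w)) := Finset.sum_le_sum fun w _ => hedge w
    _ = c₂ * edgeWeight β lam m * (c₁ * (K : ℝ≥0∞) ^ (m + 1)) *
          ∫⁻ ξ, φ (vertexAt ξ (m + 1)) ∂ν := by
        rw [← Finset.mul_sum, sum_measure_dyadic_mul ν (m + 1) φ]
    _ ≤ c₂ * edgeWeight β lam m * (c₁ * (K : ℝ≥0∞) ^ (m + 1)) * (2 ^ (p - 1) * (N + N)) :=
        mul_le_mul' le_rfl hφ
    _ = _ := by ring

/-- The extension by averages recovers `f` along almost every ray. -/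
theorem trace_extension_ae_eq {ε : ℝ} (hε : 0 < ε) {ν : Measure (Boundary K)} [IsFiniteMeasure ν]
    {f : Boundary K → ℝ} (hf : Integrable f ν) : trace (extension ε ν f) =ᵐ[ν] f := by
  filter_upwards [tendsto_mean_vertexAt hf] with ξ hξ
  simp only [trace, extension_vertex hε]
  exact hξ.limUnder_eq

/-! ### Linearity and boundedness -/

theorem mean_congr_ae {ν : Measure (Boundary K)} {f h : Boundary K → ℝ} (hfh : f =ᵐ[ν] h)
    (w : List (Fin K)) : mean ν f w = mean ν h w := by
  rw [mean, mean, setAverage_eq, setAverage_eq, integral_congr_ae (ae_restrict_of_ae hfh)]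

theorem dyadicEnergy_congr_ae {ε p θ lam : ℝ} {ν : Measure (Boundary K)} {f h : Boundary K → ℝ}
    (hfh : f =ᵐ[ν] h) : dyadicEnergy ε p θ lam ν f = dyadicEnergy ε p θ lam ν h := by
  simp only [dyadicEnergy, mean_congr_ae hfh]

theorem mean_add {ν : Measure (Boundary K)} {f h : Boundary K → ℝ} (hf : Integrable f ν)
    (hh : Integrable h ν) (w : List (Fin K)) :
    mean ν (fun ξ => f ξ + h ξ) w = mean ν f w + mean ν h w := by
  rw [mean, mean, mean, setAverage_eq, setAverage_eq, setAverage_eq,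
    integral_add hf.integrableOn hh.integrableOn, smul_add]

theorem mean_const_mul {ν : Measure (Boundary K)} (c : ℝ) (f : Boundary K → ℝ)
    (w : List (Fin K)) : mean ν (fun ξ => c * f ξ) w = c * mean ν f w := by
  rw [mean, mean, setAverage_eq, setAverage_eq, integral_const_mul]
  simp only [smul_eq_mul]
  ring

theorem extension_add {ε : ℝ} {ν : Measure (Boundary K)} {f g h : Boundary K → ℝ}
    (hm : ∀ w, mean ν h w = mean ν f w + mean ν g w) :
    extension ε ν h = extension ε ν f + extension ε ν g := by
  ext x
  simp only [extension, hm, Pi.add_apply]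
  ring

theorem extension_smul {ε : ℝ} {ν : Measure (Boundary K)} {f h : Boundary K → ℝ} {c : ℝ}
    (hm : ∀ w, mean ν h w = c * mean ν f w) :
    extension ε ν h = c • extension ε ν f := by
  ext x
  simp only [extension, hm, Pi.smul_apply, smul_eq_mul]
  ring

theorem rpow_add_rpow_le {p : ℝ} (hp : 1 ≤ p) {a b c t : ℝ≥0∞} (h : a + b ≤ c * t) :
    a ^ (1 / p) + b ^ (1 / p) ≤ 2 * c ^ (1 / p) * t ^ (1 / p) := by
  have hp0 : 0 ≤ 1 / p := by positivity
  calc a ^ (1 / p) + b ^ (1 / p) ≤ (c * t) ^ (1 / p) + (c * t) ^ (1 / p) :=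
        add_le_add (ENNReal.rpow_le_rpow (le_self_add.trans h) hp0)
          (ENNReal.rpow_le_rpow (le_add_self.trans h) hp0)
    _ = _ := by rw [ENNReal.mul_rpow_of_nonneg _ _ hp0]; ring

theorem rpow_add_le {p : ℝ} (hp : 1 ≤ p) {a b c d s t : ℝ≥0∞} (hs : s ≤ c * a ^ p)
    (ht : t ≤ d * b) :
    (s + t) ^ (1 / p) ≤ (c + d) ^ (1 / p) * (a + b ^ (1 / p)) := by
  have hp0 : 0 < p := by linarith
  have h1p : 0 ≤ 1 / p := by positivity
  have hb : b = (b ^ (1 / p)) ^ p := by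
    rw [← ENNReal.rpow_mul, one_div_mul_cancel hp0.ne', ENNReal.rpow_one]
  have ha' : a ^ p ≤ (a + b ^ (1 / p)) ^ p := ENNReal.rpow_le_rpow le_self_add hp0.le
  have hb' : b ≤ (a + b ^ (1 / p)) ^ p := by
    nth_rewrite 1 [hb]
    exact ENNReal.rpow_le_rpow le_add_self hp0.le
  have h : s + t ≤ (c + d) * (a + b ^ (1 / p)) ^ p := by
    rw [add_mul]
    exact add_le_add (hs.trans (mul_le_mul' le_rfl ha')) (ht.trans (mul_le_mul' le_rfl hb'))
  refine (ENNReal.rpow_le_rpow h h1p).trans (le_of_eq ?_)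
  rw [ENNReal.mul_rpow_of_nonneg _ _ h1p, ← ENNReal.rpow_mul _ p, mul_one_div_cancel hp0.ne',
    ENNReal.rpow_one]

end KaryTree

theorem theorem1p1 (K : ℕ) (hK : 2 ≤ K) (β ε lam C p θ : ℝ)
    (hβ : Real.log K < β) (hε : 0 < ε)
    (hC : max (2 * |lam| / (β - Real.log K)) (2 * Real.log 4 / ε) ≤ C)
    (hp : 1 ≤ p) (hpβ : (β - Real.log K) / ε < p)
    (hθ : θ = 1 - (β - Real.log K) / (ε * p))
    (ν : Measure (KaryTree.Boundary K)) (hν : KaryTree.AhlforsRegular ε ν) :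
    ∃ (T : KaryTree.newtonSpace K ε p hp (KaryTree.weightedMeasure K β lam C) →ₗ[ℝ]
          KaryTree.besovSpace ε p θ lam hε hp ν hν)
      (E : KaryTree.besovSpace ε p θ lam hε hp ν hν →ₗ[ℝ]
          KaryTree.newtonSpace K ε p hp (KaryTree.weightedMeasure K β lam C)),
      (∃ M : ℝ≥0, ∀ u : KaryTree.newtonSpace K ε p hp (KaryTree.weightedMeasure K β lam C),
        KaryTree.besovNorm ε p θ lam ν (T u).1 ≤
          M * KaryTree.newtonNorm ε p (KaryTree.weightedMeasure K β lam C) u.1) ∧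
      (∃ M : ℝ≥0, ∀ f : KaryTree.besovSpace ε p θ lam hε hp ν hν,
        KaryTree.newtonNorm ε p (KaryTree.weightedMeasure K β lam C) (E f).1 ≤
          M * KaryTree.besovNorm ε p θ lam ν f.1) ∧
      (∀ f : KaryTree.besovSpace ε p θ lam hε hp ν hν, T (E f) = f) ∧
      (∀ u : KaryTree.newtonSpace K ε p hp (KaryTree.weightedMeasure K β lam C),
        ∀ᵐ ξ ∂ν, Tendsto u.1 (KaryTree.rayFilter ξ) (𝓝 ((T u).1 ξ))) ∧
      (∀ (f : KaryTree.besovSpace ε p θ lam hε hp ν hν) (x : KaryTree.Pt K),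
        (E f).1 x = KaryTree.extension ε ν f.1 x) := by
  open KaryTree in
  have hp0 : 0 < p := by linarith
  have h1p : 0 ≤ 1 / p := by positivity
  have hfin := hν.isFiniteMeasure hε
  have hβ0 : 0 < β := lt_of_le_of_lt (Real.log_natCast_nonneg K) hβ
  have hC0 : 0 < C := by
    refine lt_of_lt_of_le ?_ ((le_max_right _ _).trans hC)
    have : 0 < Real.log 4 := Real.log_pos (by norm_num)
    positivity
  have hθ0 : 0 < θ := by
    rw [hθ, sub_pos, ← div_div, div_lt_one hp0]
    exact hpβ
  have hθ' : ε * θ * p = ε * p - (β - Real.log K) := by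
    rw [hθ]; field_simp
  have hp1 : (1 : ℝ≥0∞) ≤ ENNReal.ofReal p := by simpa using hp
  set μ := weightedMeasure K β lam C with hμ
  obtain ⟨c, hc, hcT⟩ := exists_trace_le (lam := lam) hK hβ0 hε hC0 hp hθ0 hθ' hν
  obtain ⟨c₁, hc₁, hE₁⟩ := exists_lintegral_extension_le (lam := lam) hK hβ hβ0 hε hC0 hp hν
  obtain ⟨c₂, hc₂, hE₂⟩ :=
    exists_lintegral_extensionGradient_le (lam := lam) hK hβ0 hε hC0 hp hθ' hν
  have hray : ∀ u : newtonSpace K ε p hp μ, ∃ g, IsUpperGradient ε u.1 g ∧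
      ∫⁻ x, g x ^ p ∂μ < ∞ ∧ ∀ᵐ ξ ∂ν, ∑' j, rayIncrement ε g ξ j ≠ ∞ := fun u => by
    obtain ⟨-, g, hg, hgp⟩ := (newtonNorm_lt_top hp).1 u.2.2
    exact ⟨g, hg, hgp, ae_tsum_rayIncrement_ne_top hK hβ0 hε hC0 hp hθ0 hθ' hν hg.1 hgp⟩
  have hlp : ∀ u : newtonSpace K ε p hp μ, ∫⁻ x, ENNReal.ofReal |u.1 x| ^ p ∂μ < ∞ :=
    fun u => ((newtonNorm_lt_top hp).1 u.2.2).1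
  have hmem : ∀ u : newtonSpace K ε p hp μ, MemLp (trace u.1) (ENNReal.ofReal p) ν := fun u => by
    obtain ⟨g, hg, hgp, -⟩ := hray u
    exact (hcT u.1 g hg (hlp u) hgp).1
  have hconv : ∀ u : newtonSpace K ε p hp μ, ∀ᵐ ξ ∂ν,
      Tendsto (fun n => u.1 (vertex (vertexAt ξ n))) atTop (𝓝 (trace u.1 ξ)) := fun u => by
    obtain ⟨g, hg, -, hξ⟩ := hray u
    filter_upwards [hξ] with ξ hξ using tendsto_trace hg hξ
  have hbound : ∀ u : newtonSpace K ε p hp μ,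
      ∫⁻ ξ, ENNReal.ofReal |trace u.1 ξ| ^ p ∂ν + dyadicEnergy ε p θ lam ν (trace u.1) ≤
        (c + 1) * (∫⁻ x, ENNReal.ofReal |u.1 x| ^ p ∂μ +
          ⨅ (g : Pt K → ℝ≥0∞) (_ : IsUpperGradient ε u.1 g), ∫⁻ x, g x ^ p ∂μ) := fun u => by
    -- the constant is made nonzero so that the factor commutes with the infimum
    have hc1 : c + 1 ≠ 0 := by simp
    have hc1t : c + 1 ≠ ∞ := by finiteness
    rw [iInf_subtype', ENNReal.add_iInf, ENNReal.mul_iInf_of_ne hc1 hc1t]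
    refine le_iInf fun g => ?_
    rcases eq_or_ne (∫⁻ x, g.1 x ^ p ∂μ) ∞ with h | h
    · rw [h, add_top, ENNReal.mul_top hc1]
      exact le_top
    · exact (hcT u.1 g.1 g.2 (hlp u) h.lt_top).2.trans (mul_le_mul' le_self_add le_rfl)
  have hen : ∀ u : newtonSpace K ε p hp μ,
      dyadicEnergy ε p θ lam ν ((hmem u).toLp : Boundary K → ℝ) < ∞ := fun u => by
    obtain ⟨g, hg, hgp, -⟩ := hray u
    rw [dyadicEnergy_congr_ae (hmem u).coeFn_toLp]
    refine (le_add_self.trans (hcT u.1 g hg (hlp u) hgp).2).trans_lt ?_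
    exact ENNReal.mul_lt_top hc.lt_top (ENNReal.add_lt_top.2 ⟨hlp u, hgp⟩)
  have hLpInt : ∀ f : besovSpace ε p θ lam hε hp ν hν, Integrable f.1 ν :=
    fun f => (Lp.memLp f.1).integrable hp1
  have hext : ∀ f : besovSpace ε p θ lam hε hp ν hν,
      newtonNorm ε p μ (extension ε ν f.1) ≤
        (c₁ + c₂) ^ (1 / p) * besovNorm ε p θ lam ν f.1 := fun f => by
    refine rpow_add_le hp ?_ ((iInf₂_le _ (isUpperGradient_extension hε ν f.1)).trans (hE₂ f.1))
    refine (hE₁ f.1 (hLpInt f)).trans (le_of_eq ?_)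
    rw [eLpNorm_eq_lintegral_rpow hp, ← ENNReal.rpow_mul, one_div_mul_cancel hp0.ne',
      ENNReal.rpow_one]
  have hc12 : (c₁ + c₂) ^ (1 / p) ≠ ∞ :=
    ENNReal.rpow_ne_top_of_nonneg h1p (ENNReal.add_ne_top.2 ⟨hc₁, hc₂⟩)
  have hextmem : ∀ f : besovSpace ε p θ lam hε hp ν hν,
      extension ε ν f.1 ∈ newtonSpace K ε p hp μ := fun f => by
    refine ⟨(measurable_extension hε ν f.1).aestronglyMeasurable,
      (hext f).trans_lt (ENNReal.mul_lt_top hc12.lt_top (ENNReal.add_lt_top.2 ⟨?_, ?_⟩))⟩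
    · exact (Lp.memLp f.1).2
    · exact ENNReal.rpow_lt_top_of_nonneg h1p (ne_of_lt f.2)
  let T : newtonSpace K ε p hp μ →ₗ[ℝ] besovSpace ε p θ lam hε hp ν hν :=
    { toFun := fun u => ⟨(hmem u).toLp, hen u⟩
      map_add' := fun u v => by
        refine Subtype.ext ?_
        change (hmem (u + v)).toLp = (hmem u).toLp + (hmem v).toLp
        rw [← MemLp.toLp_add, MemLp.toLp_eq_toLp_iff]
        filter_upwards [hconv u, hconv v, hconv (u + v)] with ξ h1 h2 h3
        exact tendsto_nhds_unique h3 (h1.add h2)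
      map_smul' := fun a u => by
        refine Subtype.ext ?_
        change (hmem (a • u)).toLp = a • (hmem u).toLp
        rw [← MemLp.toLp_const_smul, MemLp.toLp_eq_toLp_iff]
        filter_upwards [hconv u, hconv (a • u)] with ξ h1 h2
        exact tendsto_nhds_unique h2 (h1.const_smul a) }
  let E : besovSpace ε p θ lam hε hp ν hν →ₗ[ℝ] newtonSpace K ε p hp μ :=
    { toFun := fun f => ⟨extension ε ν f.1, hextmem f⟩
      map_add' := fun f h => by
        refine Subtype.ext (extension_add fun w => ?_)
        rw [← mean_add (hLpInt f) (hLpInt h)]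
        exact mean_congr_ae (Lp.coeFn_add f.1 h.1) w
      map_smul' := fun a f => by
        refine Subtype.ext (extension_smul fun w => ?_)
        rw [← mean_const_mul]
        exact mean_congr_ae (Lp.coeFn_smul a f.1) w }
  refine ⟨T, E, ?_, ?_, fun f => ?_, fun u => ?_, fun f x => rfl⟩
  · have hM : 2 * (c + 1) ^ (1 / p) ≠ ∞ := ENNReal.mul_ne_top (by simp)
      (ENNReal.rpow_ne_top_of_nonneg h1p (by finiteness))
    refine ⟨(2 * (c + 1) ^ (1 / p)).toNNReal, fun u => ?_⟩
    rw [ENNReal.coe_toNNReal hM]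
    change eLpNorm ((hmem u).toLp : Boundary K → ℝ) _ ν +
      dyadicEnergy ε p θ lam ν ((hmem u).toLp : Boundary K → ℝ) ^ (1 / p) ≤ _
    rw [eLpNorm_congr_ae (hmem u).coeFn_toLp, dyadicEnergy_congr_ae (hmem u).coeFn_toLp,
      eLpNorm_eq_lintegral_rpow hp]
    exact rpow_add_rpow_le hp (hbound u)
  · refine ⟨((c₁ + c₂) ^ (1 / p)).toNNReal, fun f => ?_⟩
    rw [ENNReal.coe_toNNReal hc12]
    exact hext f
  · refine Subtype.ext (Lp.ext ?_)
    exact (hmem (E f)).coeFn_toLp.trans (trace_extension_ae_eq hε (hLpInt f))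
  · obtain ⟨g, hg, -, hξ⟩ := hray u
    filter_upwards [hξ, (hmem u).coeFn_toLp] with ξ hξ hT
    change Tendsto u.1 (rayFilter ξ) (𝓝 (((hmem u).toLp : Boundary K → ℝ) ξ))
    rw [hT]
    exact tendsto_rayFilter hg hξ
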